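/- **Setting.** Systems are $\mathbb C^d$, $d\in\mathbb N$. A *dichotomy* is a pair $(\rho,\sigma)$ of density matrices on the same system with $\operatorname{supp}\rho\subseteq\operatorname{supp}\sigma$; it is *irreducible* if only multiples of the identity commute with both $\rho$ and $\sigma$. Dichotomies $(\rho_1,\sigma_1)$, $(\rho_2,\sigma_2)$ are *interconvertible*, $(\rho_1,\sigma_1)\leftrightarrow(\rho_2,\sigma_2)$, if there are completely positive trace-preserving linear maps $T,R$ with $T(\rho_1)=\rho_2$, $T(\sigma_1)=\sigma_2$, $R(\rho_2)=\rho_1$, $R(\sigma_2)=\sigma_1$. A *family of quantum Rényi divergences on* $\Lambda\subseteq[0,\infty)$ is a family $(\mathbb D_\alpha)$ of $[-\infty,\infty]$-valued functions of dichotomies such that for $\alpha\in\Lambda$: $\mathbb D_\alpha(T(\rho),T(\sigma))\le\mathbb D_\alpha(\rho,\sigma)$ for all completely positive trace-preserving $T$, and on commuting dichotomies $\mathbb D_\alpha$ is the classical Rényi divergence $\frac1{\alpha-1}\log\sum_i p_i^\alpha q_i^{1-\alpha}$ (the Kullback–Leibler divergence for $\alpha=1$). It is *anti-unitarily invariant*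 if $\mathbb D_\alpha(V\rho V^{-1},V\sigma V^{-1})=\mathbb D_\alpha(\rho,\sigma)$ for all $\alpha\in\Lambda$ and all anti-unitary operators $V$. A family $(\mathbb D_\alpha)$ is *sufficient on* $\Lambda$ if for all dichotomies $(\rho_i,\sigma_i)$, $i=1,2$, and all nonempty open intervals $(a,b)\subseteq\Lambda$ on which both $\mathbb D_\alpha(\rho_i,\sigma_i)$ are finite, $$(\rho_1,\sigma_1)\leftrightarrow(\rho_2,\sigma_2)\iff \mathbb D_\alpha(\rho_1,\sigma_1)=\mathbb D_\alpha(\rho_2,\sigma_2)\ \text{ for all }\alpha\in(a,b).$$ A *collection* of divergences is *sufficient* if two dichotomies on which all its members agree are always interconvertible. **Claim.** 1. Let $$\rho=\frac16\begin{pmatrix}2&i&i\\-i&2&i\\-i&-i&2\end{pmatrix},\qquad \sigma=\operatorname{diag}(q_1,q_2,q_3),\quad q_j>0 \text{ pairwise distinct},\ q_1+q_2+q_3=1 .$$ Then $(\rho,\sigma)$ is an irreducible dichotomy, $(\overline\rho,\sigma)$ is a dichotomy (with $\overline\rho$ the entrywise complex conjugate), and they are not interconvertible. 2. Let $(\mathbb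 D_\alpha)$ be an anti-unitarily invariant family of quantum Rényi divergences on $\Lambda\subseteq[0,\infty)$. If $\Lambda$ contains a nonempty open interval, then $(\mathbb D_\alpha)$ is not sufficient on $\Lambda$. Moreover, for every such $\Lambda$ (with or without an interval), the collection $\{\mathbb D_\alpha\}_{\alpha\in\Lambda}$ is not sufficient. 3. None of the following families is sufficient on its range $\Lambda$. Powers and logarithms of matrices are taken on supports, and values at $\alpha=1$ are the limits: the Belavkin–Staszewski entropy $D^{\rm BS}(\rho,\sigma)=\operatorname{tr}[\rho\log(\rho^{1/2}\sigma^{-1}\rho^{1/2})]$ for the maximal and sharp families, the supremum of Kullback–Leibler divergences for the measured family, and the relative entropy $D(\rho,\sigma)=\operatorname{tr}[\rho(\log\rho-\log\sigma)]$ for the Petz, minimal, $\alpha$-$z$ and log-Euclidean families. - Petz: $\frac1{\alpha-1}\log\operatorname{tr}[\rho^\alpha\sigma^{1-\alpha}]$, $\Lambda=[0,2]$. - Maximal: $\frac1{\alpha-1}\log\operatorname{tr}[\sigma(\sigma^{-1/2}\rho\sigma^{-1/2})^\alpha]$, $\Lambda=[0,2]$. - Minimal (sandwiched): $\frac1{\alpha-1}\log\operatorname{tr}[(\sigma^{\frac{1-\alpha}{2\alpha}}\rho\,\sigma^{\frac{1-\alpha}{2\alpha}})^\alpha]$,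 $\Lambda=[\frac12,\infty)$. - $\alpha$-$z$: $\frac1{\alpha-1}\log\operatorname{tr}[(\sigma^{\frac{1-\alpha}{2z}}\rho^{\frac\alpha z}\sigma^{\frac{1-\alpha}{2z}})^z]$, for any $\Lambda$ containing a nonempty open interval and any function $z=z(\alpha)$ on $\Lambda$ such that $z\ge\max(\alpha,1-\alpha)$ if $0<\alpha<1$, $z>0$ if $\alpha=1$, $\frac\alpha2\le z\le\alpha$ if $1<\alpha\le2$, $\alpha-1\le z\le\alpha$ if $\alpha\ge2$ (these are all the members of the two-parameter family). - Measured: $\sup_M D_\alpha(M(\rho),M(\sigma))$, the supremum of the classical Rényi divergences of the outcome distributions over all measurements $M$, $\Lambda=(0,\infty)$. - Sharp: $\frac1{\alpha-1}\log\inf\{\operatorname{tr}A: A\ge0,\ \rho\le\sigma^{1/2}(\sigma^{-1/2}A\sigma^{-1/2})^{1/\alpha}\sigma^{1/2}\}$, $\Lambda=[1,\infty)$. - Log-Euclidean: $\frac1{\alpha-1}\log\operatorname{tr}[P e^{\alpha\log\rho+(1-\alpha)P(\log\sigma)P}]$ with $P$ the projection onto $\operatorname{supp}\rho$, $\Lambda=[0,1]$.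 - Kringel: $\inf\{\mathbb D_\alpha(A,\sigma): A\ge\rho,\ \operatorname{supp}A\subseteq\operatorname{supp}\sigma\}$ for any family $\mathbb D_\alpha$ of this list with range $\Lambda'$ (given by the same formula for unnormalized $A$), $\Lambda=\Lambda'\cap(1,\infty)$, provided this contains a nonempty open interval. - Barycentric: $\frac1{\alpha-1}\log\sup\{\operatorname{tr}\tau-\alpha D^{(0)}(\tau,\rho)-(1-\alpha)D^{(1)}(\tau,\sigma): \tau\ge0,\ \operatorname{supp}\tau\subseteq\operatorname{supp}\rho\}$, where $D^{(0)},D^{(1)}$ are members at $\alpha=1$ of families of this list, $\Lambda=[0,1)$. 4. Neither the collection of all standard $f$-divergences $\langle\sqrt\sigma, f(\Delta_{\rho,\sigma})\sqrt\sigma\rangle$ (Hilbert–Schmidt inner product, $\Delta_{\rho,\sigma}A=\rho A\sigma^{-1}$) nor that of all maximal $f$-divergences $\operatorname{tr}[\sigma f(\sigma^{-1/2}\rho\sigma^{-1/2})]$, where $f:(0,\infty)\to\mathbb R$ ranges over the convex functions and $f(0):=f(0+)\in(-\infty,\infty]$, is sufficient. 5. The collection of all divergences in 3 and 4 taken together is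 not sufficient. -/

import Mathlib

open scoped Matrix Kronecker ComplexOrder

noncomputable section

namespace QuantumDichotomy

/-- Operators on the quantum system with Hilbert space `ℂ^d`. -/
abbrev Mat (d : ℕ) : Type := Matrix (Fin d) (Fin d) ℂ

/-! ### States, dichotomies, channels, interconvertibility -/

/-- `ρ` is a density matrix. -/
def IsState {d : ℕ} (ρ : Mat d) : Prop := ρ.PosSemidef ∧ ρ.trace = 1

/-- Support inclusion `supp ρ ⊆ supp σ`; the support of a Hermitian matrix is its range. -/
def SuppLE {d : ℕ} (ρ σ : Mat d) : Prop :=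
  LinearMap.range ρ.mulVecLin ≤ LinearMap.range σ.mulVecLin

/-- `(ρ, σ)` is a dichotomy: a pair of states with `supp ρ ⊆ supp σ`. -/
def IsDichotomy {d : ℕ} (ρ σ : Mat d) : Prop := IsState ρ ∧ IsState σ ∧ SuppLE ρ σ

/-- The matrix of `(id_k ⊗ T) M`, i.e. `T` applied to every block of `M`. -/
def ampliate {d e : ℕ} (k : ℕ) (T : Mat d →ₗ[ℂ] Mat e)
    (M : Matrix (Fin k × Fin d) (Fin k × Fin d) ℂ) :
    Matrix (Fin k × Fin e) (Fin k × Fin e) ℂ :=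
  Matrix.of fun x y => T (Matrix.of fun a b => M (x.1, a) (y.1, b)) x.2 y.2

/-- Complete positivity: `id_k ⊗ T` maps positive matrices to positive matrices for all `k`. -/
def IsCompletelyPositive {d e : ℕ} (T : Mat d →ₗ[ℂ] Mat e) : Prop :=
  ∀ (k : ℕ) (M : Matrix (Fin k × Fin d) (Fin k × Fin d) ℂ),
    M.PosSemidef → (ampliate k T M).PosSemidef

/-- A quantum channel: a completely positive trace-preserving linear map. -/
def IsChannel {d e : ℕ} (T : Mat d →ₗ[ℂ] Mat e) : Prop :=
  IsCompletelyPositive T ∧ ∀ A : Mat d, (T A).trace = A.trace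

/-- `(ρ₁, σ₁) ⟷ (ρ₂, σ₂)`: there are channels in both directions. -/
def Interconvertible {d e : ℕ} (ρ₁ σ₁ : Mat d) (ρ₂ σ₂ : Mat e) : Prop :=
  (∃ T : Mat d →ₗ[ℂ] Mat e, IsChannel T ∧ T ρ₁ = ρ₂ ∧ T σ₁ = σ₂) ∧
  (∃ R : Mat e →ₗ[ℂ] Mat d, IsChannel R ∧ R ρ₂ = ρ₁ ∧ R σ₂ = σ₁)

/-- `(ρ, σ)` is irreducible: only multiples of the identity commute with both `ρ` and `σ`. -/
def IsIrreducibleDichotomy {d : ℕ} (ρ σ : Mat d) : Prop :=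
  ∀ A : Mat d, ρ * A = A * ρ → σ * A = A * σ → ∃ c : ℂ, A = c • (1 : Mat d)

/-- Entrywise complex conjugation. -/
def conj {d : ℕ} (A : Mat d) : Mat d := A.map (starRingEnd ℂ)

/-! ### Divergences, Rényi families, sufficiency -/

/-- An extended-real-valued function of pairs of operators on an arbitrary system `ℂ^d`.
Only its values on pairs `(A, σ)` with `A, σ ≥ 0` and `supp A ⊆ supp σ` are ever meaningful. -/
abbrev Divergence : Type := ∀ d : ℕ, Mat d → Mat d → EReal

/-- Real powers with the convention `0 ^ s = 0` for every `s`, so that functional calculus yields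
powers on the support (for negative `s`: powers of the pseudo-inverse; for `s = 0`: the support
projection). -/
def suppPow (s x : ℝ) : ℝ := if x = 0 then 0 else x ^ s

/-- The classical Rényi divergence of finitely supported `p ≪ q`; at `α = 1` it is the
Kullback–Leibler divergence. -/
def classicalRenyi {m : ℕ} (α : ℝ) (p q : Fin m → ℝ) : ℝ :=
  if α = 1 then ∑ i, p i * Real.log (p i / q i)
  else 1 / (α - 1) * Real.log (∑ i, suppPow α (p i) * suppPow (1 - α) (q i))

/-- `D` is a family of quantum Rényi divergences with data processing on `Λ`: for `α ∈ Λ` it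
satisfies the data-processing inequality on dichotomies and gives the classical Rényi divergence
on diagonal dichotomies (hence, by data processing under unitary conjugation, on all commuting
ones). -/
structure IsRenyiFamily (Λ : Set ℝ) (D : ℝ → Divergence) : Prop where
  dataProcessing : ∀ α ∈ Λ, ∀ (d e : ℕ) (ρ σ : Mat d) (T : Mat d →ₗ[ℂ] Mat e),
    IsDichotomy ρ σ → IsChannel T → D α e (T ρ) (T σ) ≤ D α d ρ σ
  classical : ∀ α ∈ Λ, ∀ (d : ℕ) (p q : Fin d → ℝ),
    IsDichotomy (Matrix.diagonal fun i => (p i : ℂ)) (Matrix.diagonal fun i => (q i : ℂ)) →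
      D α d (Matrix.diagonal fun i => (p i : ℂ)) (Matrix.diagonal fun i => (q i : ℂ)) =
        (classicalRenyi α p q : EReal)

/-- Invariance under conjugation by anti-unitary operators. Every anti-unitary operator on `ℂ^d`
is `V = U K` with `U` unitary and `K` the entrywise complex conjugation of vectors, and
`V A V⁻¹ = U (conj A) Uᴴ`. -/
def IsAntiUnitarilyInvariant (Λ : Set ℝ) (D : ℝ → Divergence) : Prop :=
  ∀ α ∈ Λ, ∀ (d : ℕ) (ρ σ U : Mat d), IsDichotomy ρ σ → U ∈ Matrix.unitaryGroup (Fin d) ℂ →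
    D α d (U * conj ρ * Uᴴ) (U * conj σ * Uᴴ) = D α d ρ σ

/-- The family `D` (with data processing on `Λ`) is sufficient: on every open interval
`(a, b) ⊆ Λ` on which both dichotomies have finite divergences, interconvertibility is equivalent
to equality of the divergences. -/
def IsSufficient (Λ : Set ℝ) (D : ℝ → Divergence) : Prop :=
  ∀ (d e : ℕ) (ρ₁ σ₁ : Mat d) (ρ₂ σ₂ : Mat e), IsDichotomy ρ₁ σ₁ → IsDichotomy ρ₂ σ₂ →
    ∀ a b : ℝ, a < b → Set.Ioo a b ⊆ Λ →
      (∀ α ∈ Set.Ioo a b, (D α d ρ₁ σ₁ ≠ ⊤ ∧ D α d ρ₁ σ₁ ≠ ⊥) ∧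
        (D α e ρ₂ σ₂ ≠ ⊤ ∧ D α e ρ₂ σ₂ ≠ ⊥)) →
      (Interconvertible ρ₁ σ₁ ρ₂ σ₂ ↔ ∀ α ∈ Set.Ioo a b, D α d ρ₁ σ₁ = D α e ρ₂ σ₂)

/-- A collection of divergences is sufficient: if all of them agree on two dichotomies, these are
interconvertible. -/
def IsSufficientCollection (S : Set Divergence) : Prop :=
  ∀ (d e : ℕ) (ρ₁ σ₁ : Mat d) (ρ₂ σ₂ : Mat e), IsDichotomy ρ₁ σ₁ → IsDichotomy ρ₂ σ₂ →
    (∀ D ∈ S, D d ρ₁ σ₁ = D e ρ₂ σ₂) → Interconvertible ρ₁ σ₁ ρ₂ σ₂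

/-! ### The known families -/

/-- The power `A ^ s` of a positive semidefinite matrix, taken on its support. -/
def mpow {d : ℕ} (s : ℝ) (A : Mat d) : Mat d := cfc (suppPow s) A

/-- The logarithm of a positive semidefinite matrix on its support, zero on the kernel. -/
def mlog {d : ℕ} (A : Mat d) : Mat d := cfc Real.log A

/-- The real number `tr A`, for operators with real trace. -/
def rtr {d : ℕ} (A : Mat d) : ℝ := A.trace.re

/-- Umegaki's relative entropy `tr[ρ (log ρ - log σ)]`. -/
def relEntropy {d : ℕ} (ρ σ : Mat d) : ℝ := rtr (ρ * (mlog ρ - mlog σ))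

/-- The Belavkin–Staszewski relative entropy `tr[ρ log(ρ^{1/2} σ⁻¹ ρ^{1/2})]`. -/
def bsEntropy {d : ℕ} (ρ σ : Mat d) : ℝ :=
  rtr (ρ * mlog (mpow (1 / 2) ρ * mpow (-1) σ * mpow (1 / 2) ρ))

/-- `σ^{-1/2} A σ^{-1/2}`. -/
def relOp {d : ℕ} (A σ : Mat d) : Mat d := mpow (-(1 / 2)) σ * A * mpow (-(1 / 2)) σ

/-- Petz quantum Rényi divergence. -/
def petz (α : ℝ) : Divergence := fun _ ρ σ =>
  ((if α = 1 then relEntropy ρ σ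
    else 1 / (α - 1) * Real.log (rtr (mpow α ρ * mpow (1 - α) σ)) : ℝ) : EReal)

/-- Maximal (geometric) quantum Rényi divergence. -/
def maximal (α : ℝ) : Divergence := fun _ ρ σ =>
  ((if α = 1 then bsEntropy ρ σ
    else 1 / (α - 1) * Real.log (rtr (σ * mpow α (relOp ρ σ))) : ℝ) : EReal)

/-- The `α`-`z` quantum Rényi divergence. -/
def alphaZ (α z : ℝ) : Divergence := fun _ ρ σ =>
  ((if α = 1 then relEntropy ρ σ
    else 1 / (α - 1) * Real.log (rtr (mpow z
      (mpow ((1 - α) / (2 * z)) σ * mpow (α / z) ρ * mpow ((1 - α) / (2 * z)) σ))) : ℝ) : EReal)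

/-- The parameters for which `alphaZ` obeys data processing (`α = 1` is the limiting case). -/
def AlphaZRange (α z : ℝ) : Prop :=
  (0 < α ∧ α < 1 ∧ max α (1 - α) ≤ z) ∨ (α = 1 ∧ 0 < z) ∨
    (1 < α ∧ α ≤ 2 ∧ α / 2 ≤ z ∧ z ≤ α) ∨ (2 ≤ α ∧ α - 1 ≤ z ∧ z ≤ α)

/-- Minimal (sandwiched) quantum Rényi divergence. -/
def minimal (α : ℝ) : Divergence := fun _ ρ σ =>
  ((if α = 1 then relEntropy ρ σ
    else 1 / (α - 1) * Real.log (rtr (mpow α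
      (mpow ((1 - α) / (2 * α)) σ * ρ * mpow ((1 - α) / (2 * α)) σ))) : ℝ) : EReal)

/-- Measured quantum Rényi divergence: the supremum of the classical Rényi divergences of the
outcome distributions over all (finite-outcome) measurements. -/
def measured (α : ℝ) : Divergence := fun d ρ σ =>
  ⨆ (m : ℕ) (M : Fin m → Mat d) (_ : (∀ i, (M i).PosSemidef) ∧ ∑ i, M i = 1),
    ((classicalRenyi α (fun i => rtr (M i * ρ)) (fun i => rtr (M i * σ)) : ℝ) : EReal)

/-- Weighted geometric mean `σ #_β A = σ^{1/2} (σ^{-1/2} A σ^{-1/2})^β σ^{1/2}`. -/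
def geomMean {d : ℕ} (β : ℝ) (σ A : Mat d) : Mat d :=
  mpow (1 / 2) σ * mpow β (relOp A σ) * mpow (1 / 2) σ

/-- Sharp quantum Rényi divergence, from `Q = inf {tr A | A ≥ 0, ρ ≤ σ #_{1/α} A}`. -/
def sharp (α : ℝ) : Divergence := fun d ρ σ =>
  ((if α = 1 then bsEntropy ρ σ
    else 1 / (α - 1) * Real.log (sInf {t : ℝ | ∃ A : Mat d, A.PosSemidef ∧
      (geomMean (1 / α) σ A - ρ).PosSemidef ∧ t = rtr A}) : ℝ) : EReal)

/-- Log-Euclidean quantum Rényi divergence. If `ρ` is not invertible, the exponential is taken on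
the support of `ρ`, with `P` the support projection, as is the limit `z → ∞` of the
`α`-`z` divergences. -/
def logEuclidean (α : ℝ) : Divergence := fun _ ρ σ =>
  let P := mpow 0 ρ
  ((if α = 1 then relEntropy ρ σ
    else 1 / (α - 1) * Real.log (rtr (P * cfc Real.exp
      ((α : ℂ) • mlog ρ + ((1 - α : ℝ) : ℂ) • (P * mlog σ * P)))) : ℝ) : EReal)

/-- The Kringel divergence `inf_{A ≥ ρ} D(A, σ)` generated by `D`; here `A` need not be normalized,
and `D(A, σ)` counts as `∞` unless `supp A ⊆ supp σ`. -/
def kringel (D : Divergence) : Divergence := fun d ρ σ =>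
  ⨅ (A : Mat d) (_ : (A - ρ).PosSemidef ∧ SuppLE A σ), D d A σ

/-- The barycentric Rényi divergence generated by `D₀` and `D₁`, from
`Q = sup {tr τ - α D₀(τ, ρ) - (1 - α) D₁(τ, σ) | τ ≥ 0, supp τ ⊆ supp ρ}`. -/
def barycentric (α : ℝ) (D₀ D₁ : Divergence) : Divergence := fun d ρ σ =>
  ((1 / (α - 1) : ℝ) : EReal) * ENNReal.log (EReal.toENNReal
    (⨆ (τ : Mat d) (_ : τ.PosSemidef ∧ SuppLE τ ρ),
      ((rtr τ : EReal) - (α : EReal) * D₀ d τ ρ - ((1 - α : ℝ) : EReal) * D₁ d τ σ)))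

/-- `KnownFamily Λ D`: the family `D` is one of the known families of quantum Rényi divergences,
and `Λ` is its range of parameters. For the two-parameter `α`-`z` divergences, `z` may depend on
`α` in an arbitrary way. Kringel and barycentric divergences are generated by the known families,
the latter by their members at `α = 1` (relative entropies). -/
inductive KnownFamily : Set ℝ → (ℝ → Divergence) → Prop
  | petz : KnownFamily (Set.Icc 0 2) petz
  | maximal : KnownFamily (Set.Icc 0 2) maximal
  | minimal : KnownFamily (Set.Ici (1 / 2)) minimal
  | alphaZ (Λ : Set ℝ) (z : ℝ → ℝ) (h : ∀ α ∈ Λ, AlphaZRange α (z α)) :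
      KnownFamily Λ fun α => alphaZ α (z α)
  | measured : KnownFamily (Set.Ioi 0) measured
  | sharp : KnownFamily (Set.Ici 1) sharp
  | logEuclidean : KnownFamily (Set.Icc 0 1) logEuclidean
  | kringel (Λ : Set ℝ) (D : ℝ → Divergence) (h : KnownFamily Λ D) :
      KnownFamily (Λ ∩ Set.Ioi 1) fun α => kringel (D α)
  | barycentric (Λ₀ Λ₁ : Set ℝ) (D₀ D₁ : ℝ → Divergence) (h₀ : KnownFamily Λ₀ D₀)
      (h₁ : KnownFamily Λ₁ D₁) (m₀ : (1 : ℝ) ∈ Λ₀) (m₁ : (1 : ℝ) ∈ Λ₁) :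
      KnownFamily (Set.Ico 0 1) fun α => barycentric α (D₀ 1) (D₁ 1)

/-- The extension of `f : (0, ∞) → ℝ` to `0` by its limit `f(0+) ∈ (-∞, ∞]`, which exists for
convex `f`. -/
def extendZero (f : ℝ → ℝ) (t : ℝ) : EReal :=
  if 0 < t then (f t : EReal)
  else Filter.limsup (fun s => (f s : EReal)) (nhdsWithin 0 (Set.Ioi 0))

/-- `tr[S f(H)] = ∑_λ f(λ) tr[S P_λ]` for positive semidefinite `S` and `H`, where the `P_λ` are
the spectral projections of `H` and `f(0)` is read as `f(0+)`; only eigenvalues `λ` of `H`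
contribute. -/
def trFun {n : Type} [Fintype n] [DecidableEq n] (f : ℝ → ℝ) (H S : Matrix n n ℂ) : EReal :=
  ∑ᶠ t : ℝ, extendZero f t *
    (((S * cfc (fun x : ℝ => if x = t then (1 : ℝ) else 0) H).trace.re : ℝ) : EReal)

/-- The standard quantum `f`-divergence `⟨√σ| f(Δ) |√σ⟩`, where `Δ A = ρ A σ⁻¹` is the relative
modular operator on the Hilbert–Schmidt operators, written as a matrix on `ℂ^d ⊗ ℂ^d`. -/
def standardF (f : ℝ → ℝ) : Divergence := fun d ρ σ =>
  let v : Fin d × Fin d → ℂ := fun x => mpow (1 / 2) σ x.1 x.2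
  trFun f (ρ ⊗ₖ (mpow (-1) σ)ᵀ) (Matrix.vecMulVec v (star v))

/-- The maximal quantum `f`-divergence `tr[σ f(σ^{-1/2} ρ σ^{-1/2})]`. -/
def maximalF (f : ℝ → ℝ) : Divergence := fun _ ρ σ => trFun f (relOp ρ σ) σ

/-- All standard quantum `f`-divergences of convex functions `f : (0, ∞) → ℝ`. -/
def standardFDivergences : Set Divergence :=
  {D | ∃ f : ℝ → ℝ, ConvexOn ℝ (Set.Ioi 0) f ∧ D = standardF f}

/-- All maximal quantum `f`-divergences of convex functions `f : (0, ∞) → ℝ`. -/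
def maximalFDivergences : Set Divergence :=
  {D | ∃ f : ℝ → ℝ, ConvexOn ℝ (Set.Ioi 0) f ∧ D = maximalF f}

/-- All members of all known families of quantum Rényi divergences. -/
def knownRenyiDivergences : Set Divergence :=
  {D | ∃ (Λ : Set ℝ) (F : ℝ → Divergence), KnownFamily Λ F ∧ ∃ α ∈ Λ, D = F α}

/-! ### The explicit state -/

/-- The state `ρ = (1/6) [[2, i, i], [-i, 2, i], [-i, -i, 2]]`. -/
def rho3 : Mat 3 :=
  (1 / 6 : ℂ) • !![2, Complex.I, Complex.I;
                   -Complex.I, 2, Complex.I;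
                   -Complex.I, -Complex.I, 2]

/-- The diagonal matrix with real diagonal `q`. -/
def diag {d : ℕ} (q : Fin d → ℝ) : Mat d := Matrix.diagonal fun i => (q i : ℂ)

end QuantumDichotomy

end

namespace QuantumDichotomy

/-! ### Kraus operators -/

section Kraus
open scoped MatrixOrder

/-! The counterexample is a dichotomy together with its complex conjugate. Every divergence built
from functional calculus, traces and optimization over operators takes the same value on `(rho3,
diag q)` and `(conj rho3, diag q)`, because entrywise conjugation is a real star-algebra
automorphism which preserves real parts of traces and permutes the feasible sets. It remains to show
that no channel `T` maps `rho3` to `conj rho3` while fixing `σ = diag q`.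

For `s > 0` the quadratic form `X ↦ ∑ |X i j|² / (s q i + q j)` cannot increase under channels
fixing `σ`. It agrees on `rho3` and its conjugate, as only the moduli of entries enter. The gap in
the inequality is a sum of squares over the Kraus operators `K` of `T`, so all squares vanish. This
gives intertwining relations `Y'ₛ K = K Yₛ` between the rescaled matrices (`kraus_intertwine`). As
functions of `s` these are rational, and for distinct `q i` the residue at `s = -1` forces `K` to be
diagonal (`residue_eq_zero`, `intertwiner_diagonal`). Off the diagonal, `conj rho3 = -rho3` then
makes any two diagonal entries of `K` negatives of each other. Among three indices this is possible
only for `K = 0`, which contradicts `T σ = σ`.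

Sufficiency of a family is tested only on intervals where its values are finite, so finiteness at
one reference pair is also needed. For abstract families it follows from data processing
(`IsRenyiFamily.ne_bot`, `IsRenyiFamily.ne_top`). For the known families it follows from explicit
bounds using that both states lie between `1 / 24` and `1` (`KnownFamily.ne_top_bot`). The
nontrivial cases are the measured, Kringel and barycentric divergences. -/

theorem exists_eq_conjTranspose_mul_self {n : Type*} [Fintype n] [DecidableEq n]
    {A : Matrix n n ℂ} (hA : A.PosSemidef) : ∃ B : Matrix n n ℂ, A = Bᴴ * B :=
  CStarAlgebra.nonneg_iff_eq_star_mul_self.mp hA.nonneg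

end Kraus

/-- A completely positive map has a Kraus decomposition. -/
theorem IsCompletelyPositive.exists_kraus {d e : ℕ} {T : Mat d →ₗ[ℂ] Mat e}
    (hT : IsCompletelyPositive T) :
    ∃ K : Fin d × Fin e → Matrix (Fin e) (Fin d) ℂ, ∀ X, T X = ∑ m, K m * X * (K m)ᴴ := by
  -- The unnormalized maximally entangled vector: `T` applied blockwise to its projector is the Choi
  -- matrix, and the conjugated rows of a factor `B` of that matrix are the Kraus operators.
  let v : Fin d × Fin d → ℂ := fun x => if x.1 = x.2 then 1 else 0
  obtain ⟨B, hB⟩ := exists_eq_conjTranspose_mul_self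
    (hT d _ (Matrix.posSemidef_vecMulVec_self_star v))
  refine ⟨fun m => Matrix.of fun a i => star (B m (i, a)), fun X => ?_⟩
  have hsingle : ∀ i j a b, T (Matrix.single i j 1) a b =
      ∑ m, star (B m (i, a)) * B m (j, b) := by
    intro i j a b
    have h := congrFun (congrFun hB (i, a)) (j, b)
    rw [Matrix.mul_apply] at h
    simp only [ampliate, Matrix.of_apply, Matrix.conjTranspose_apply] at h
    rw [← h]
    refine congrArg (fun Z => T Z a b) ?_
    ext p q
    simp only [Matrix.single, Matrix.of_apply, Matrix.vecMulVec_apply, v, Pi.star_apply]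
    by_cases h1 : i = p <;> by_cases h2 : j = q <;> simp [h1, h2]
  ext a b
  conv_lhs => rw [Matrix.matrix_eq_sum_single X]
  have hX : ∀ i j, Matrix.single i j (X i j) = X i j • Matrix.single i j (1 : ℂ) := by
    intro i j; simp [Matrix.smul_single]
  simp only [hX, map_sum, map_smul, Matrix.sum_apply, Matrix.smul_apply, hsingle, smul_eq_mul,
    Matrix.mul_apply, Matrix.of_apply, Matrix.conjTranspose_apply, star_star, Finset.sum_mul,
    Finset.mul_sum]
  rw [Finset.sum_comm]
  conv_lhs => enter [2, j]; rw [Finset.sum_comm]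
  rw [Finset.sum_comm]
  refine Finset.sum_congr rfl fun m _ => Finset.sum_congr rfl fun j _ =>
    Finset.sum_congr rfl fun i _ => by ring

/-! ### Rigidity of pairs of equal weighted norm -/

/-- Writes a defect as a positively weighted sum of squares, so that a vanishing defect kills every
entry of `Z`. -/
theorem trace_mul_diag_mul_conjTranspose {d : ℕ} (Z : Mat d) (q : Fin d → ℝ) :
    (Z * diag q * Zᴴ).trace = ((∑ i, ∑ j, q j * ‖Z i j‖ ^ 2 : ℝ) : ℂ) := by
  simp only [Matrix.trace, Matrix.diag_apply, Matrix.mul_apply (M := Z * diag q)]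
  simp only [diag, Matrix.mul_diagonal, Matrix.conjTranspose_apply, Complex.ofReal_sum, Complex.ofReal_mul, Complex.ofReal_pow]
  refine Finset.sum_congr rfl fun i _ => Finset.sum_congr rfl fun j _ => ?_
  rw [← Complex.mul_conj' (Z i j)]
  simp; ring

/-- If a channel in Kraus form fixes `diag q` and preserves the norm of `X` with weights
`(s qᵢ + qⱼ)⁻¹`, then its Kraus operators intertwine the rescaled matrices. -/
theorem kraus_intertwine {d : ℕ} {ι : Type*} [Fintype ι] {q : Fin d → ℝ} (hq : ∀ i, 0 < q i)
    {K : ι → Mat d} {T : Mat d →ₗ[ℂ] Mat d} (hK : ∀ X, T X = ∑ m, K m * X * (K m)ᴴ)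
    (htr : ∀ X, (T X).trace = X.trace) (hσ : T (diag q) = diag q)
    {X X' : Mat d} (hX : T X = X') (hnorm : ∀ i j, ‖X' i j‖ = ‖X i j‖) {s : ℝ} (hs : 0 < s)
    (m : ι) :
    (Matrix.of fun i j => X' i j / ((s * q i + q j : ℝ) : ℂ)) * K m =
      K m * Matrix.of fun i j => X i j / ((s * q i + q j : ℝ) : ℂ) := by
  set Y : Mat d := Matrix.of fun i j => X i j / ((s * q i + q j : ℝ) : ℂ) with hY
  set Y' : Mat d := Matrix.of fun i j => X' i j / ((s * q i + q j : ℝ) : ℂ) with hY'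
  have hw : ∀ i j, ((s * q i + q j : ℝ) : ℂ) ≠ 0 := fun i j => by
    have := hq i; have := hq j
    exact_mod_cast (by positivity : s * q i + q j ≠ 0)
  -- With `σ = diag q`, dividing by `s q i + q j` solves the Sylvester equation `V σ + s σ V = U`.
  have rec1 : ∀ (U V : Mat d), (V = Matrix.of fun i j => U i j / ((s * q i + q j : ℝ) : ℂ)) →
      V * diag q + (s : ℂ) • (diag q * V) = U := by
    rintro U V rfl
    ext i j
    have := hw i j
    simp only [diag, Matrix.add_apply, Matrix.mul_diagonal, Matrix.smul_apply,
      Matrix.diagonal_mul, Matrix.of_apply, smul_eq_mul]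
    field_simp
    push_cast
    ring
  have hXr := rec1 X Y hY
  have hX'r := rec1 X' Y' hY'
  have hdH : (diag q)ᴴ = diag q := by
    ext i j; by_cases h : i = j <;> simp [diag, h, Ne.symm]
  have hTH : ∀ A, T Aᴴ = (T A)ᴴ := by
    intro A
    simp [hK, Matrix.conjTranspose_sum, Matrix.mul_assoc]
  have hXrH : diag q * Yᴴ + (s : ℂ) • (Yᴴ * diag q) = Xᴴ := by
    rw [← hXr]; simp [hdH]
  have hTXH : T Xᴴ = X'ᴴ := by rw [hTH, hX]
  -- expansion of the defects
  have expand : ∀ W W' : Mat d,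
      ∑ m, ((W' * K m - K m * W) * diag q * (W' * K m - K m * W)ᴴ).trace =
        (W' * diag q * W'ᴴ).trace - (W' * T (diag q * Wᴴ)).trace
          - (T (W * diag q) * W'ᴴ).trace + (W * diag q * Wᴴ).trace := by
    intro W W'
    conv_rhs => rw [← htr (W * diag q * Wᴴ)]
    conv_rhs => enter [1, 1, 1]; rw [← hσ]
    simp only [hK, Matrix.mul_sum, Matrix.sum_mul, Matrix.trace_sum, ← Finset.sum_sub_distrib,
      ← Finset.sum_add_distrib]
    refine Finset.sum_congr rfl fun m _ => ?_
    simp only [Matrix.conjTranspose_sub, Matrix.conjTranspose_mul, Matrix.sub_mul,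
      Matrix.mul_sub, Matrix.trace_sub, Matrix.mul_assoc]
    ring
  have quad : ∀ U V : Mat d, V * diag q + (s : ℂ) • (diag q * V) = U →
      (V * diag q * Vᴴ).trace + s * (Vᴴ * diag q * V).trace = (U * Vᴴ).trace := by
    rintro U V rfl
    rw [Matrix.add_mul, Matrix.trace_add, Matrix.smul_mul, Matrix.trace_smul,
      Matrix.trace_mul_comm (diag q * V), Matrix.mul_assoc Vᴴ]
    rfl
  have v1 := quad X Y hXr
  have v2 := quad X' Y' hX'r
  have hV : (X' * Y'ᴴ).trace = (X * Yᴴ).trace := by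
    simp only [Matrix.trace, Matrix.diag_apply, Matrix.mul_apply, hY, hY', Matrix.of_apply,
      Matrix.conjTranspose_apply]
    refine Finset.sum_congr rfl fun i _ => Finset.sum_congr rfl fun j _ => ?_
    have e : ∀ z : ℂ, ∀ w : ℝ, z * star (z / (w : ℂ)) = ((‖z‖ ^ 2 : ℝ) : ℂ) / w := by
      intro z w
      push_cast
      rw [← Complex.mul_conj' z]
      simp [mul_div_assoc]
    rw [e, e, hnorm]
  have hVself : (Y' * X'ᴴ).trace = (X' * Y'ᴴ).trace := by
    simp only [Matrix.trace, Matrix.diag_apply, Matrix.mul_apply, hY', Matrix.of_apply,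
      Matrix.conjTranspose_apply]
    refine Finset.sum_congr rfl fun i _ => Finset.sum_congr rfl fun j _ => ?_
    simp
    ring
  -- By the Sylvester equations, the diagonal terms of the two defects add up to `tr X'Y'ᴴ + tr XYᴴ`
  -- and the cross terms to `tr X'Y'ᴴ + tr Y'X'ᴴ`. All of these traces coincide because the entries
  -- of `X` and `X'` have equal moduli.
  have key : ∑ m, ((Y' * K m - K m * Y) * diag q * (Y' * K m - K m * Y)ᴴ).trace +
      s * ∑ m, ((Y'ᴴ * K m - K m * Yᴴ) * diag q * (Y'ᴴ * K m - K m * Yᴴ)ᴴ).trace = 0 := by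
    rw [expand, expand]
    simp only [Matrix.conjTranspose_conjTranspose]
    have c1 : (T (Y * diag q) * Y'ᴴ).trace + s * (Y'ᴴ * T (diag q * Y)).trace =
        (X' * Y'ᴴ).trace := by
      have e : T (Y * diag q) + (s : ℂ) • T (diag q * Y) = X' := by
        rw [← map_smul, ← map_add, hXr, hX]
      rw [← e, Matrix.trace_mul_comm Y'ᴴ, Matrix.add_mul, Matrix.trace_add, Matrix.smul_mul,
        Matrix.trace_smul, smul_eq_mul]
    have c2 : (Y' * T (diag q * Yᴴ)).trace + s * (T (Yᴴ * diag q) * Y').trace =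
        (Y' * X'ᴴ).trace := by
      have e : T (diag q * Yᴴ) + (s : ℂ) • T (Yᴴ * diag q) = X'ᴴ := by
        rw [← map_smul, ← map_add, hXrH, hTXH]
      rw [← e, Matrix.trace_mul_comm (T (Yᴴ * diag q)), Matrix.mul_add, Matrix.trace_add,
        Matrix.mul_smul, Matrix.trace_smul, smul_eq_mul]
    linear_combination v1 + v2 - c1 - c2 - hV + (-1) * hVself
  have hnn : ∀ Z : Mat d, 0 ≤ ∑ i, ∑ j, q j * ‖Z i j‖ ^ 2 := fun Z =>
    Finset.sum_nonneg fun i _ => Finset.sum_nonneg fun j _ => by have := hq j; positivity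
  simp only [trace_mul_diag_mul_conjTranspose] at key
  rw [← Complex.ofReal_sum, ← Complex.ofReal_sum, ← Complex.ofReal_mul, ← Complex.ofReal_add,
    Complex.ofReal_eq_zero] at key
  have h1 := Finset.sum_nonneg fun m (_ : m ∈ Finset.univ) => hnn (Y' * K m - K m * Y)
  have h2 := Finset.sum_nonneg fun m (_ : m ∈ Finset.univ) => hnn (Y'ᴴ * K m - K m * Yᴴ)
  have h3 : ∑ m, ∑ i, ∑ j, q j * ‖(Y' * K m - K m * Y) i j‖ ^ 2 = 0 := by
    nlinarith [mul_nonneg hs.le h2]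
  rw [Finset.sum_eq_zero_iff_of_nonneg fun m _ => hnn _] at h3
  have h4 := h3 m (Finset.mem_univ _)
  rw [Finset.sum_eq_zero_iff_of_nonneg fun i _ => Finset.sum_nonneg fun j _ => by
    have := hq j; positivity] at h4
  rw [← sub_eq_zero]
  ext i j
  have h5 := h4 i (Finset.mem_univ _)
  rw [Finset.sum_eq_zero_iff_of_nonneg fun j _ => by have := hq j; positivity] at h5
  have h6 := h5 j (Finset.mem_univ _)
  simpa [(hq j).ne'] using h6

open Polynomial in
/-- A combination of simple fractions vanishing on `(0, ∞)` has no residue at `-1`. -/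
theorem residue_eq_zero {ι : Type*} [DecidableEq ι] (S : Finset ι) (c₀ : ℂ) (c : ι → ℂ)
    (u v : ι → ℝ) (hu : ∀ l, 0 < u l) (hv : ∀ l, 0 < v l) (huv : ∀ l ∈ S, u l ≠ v l)
    (h : ∀ s : ℝ, 0 < s → c₀ / ((s : ℂ) + 1) + ∑ l ∈ S, c l / ((s * u l + v l : ℝ) : ℂ) = 0) :
    c₀ = 0 := by
  let L : ι → ℂ[X] := fun l => C (u l : ℂ) * X + C (v l : ℂ)
  -- The sum of fractions after clearing denominators. At `-1` only the first summand survives, and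
  -- its factors `v l - u l` are nonzero.
  let P : ℂ[X] := C c₀ * ∏ l ∈ S, L l + (X + 1) * ∑ l ∈ S, C (c l) * ∏ k ∈ S.erase l, L k
  have hP : P = 0 := by
    refine Polynomial.eq_zero_of_infinite_isRoot P (Set.Infinite.mono
      (s := (fun x : ℝ => (x : ℂ)) '' Set.Ioi 0) ?_
      ((Set.Ioi_infinite 0).image Complex.ofReal_injective.injOn))
    rintro _ ⟨s, hs, rfl⟩
    have hs' : (0 : ℝ) < s := hs
    have hL : ∀ l, eval (s : ℂ) (L l) = ((s * u l + v l : ℝ) : ℂ) := by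
      intro l; simp [L]; ring
    have hne : ∀ l, ((s * u l + v l : ℝ) : ℂ) ≠ 0 := fun l => by
      have := hu l; have := hv l
      exact_mod_cast (by positivity : s * u l + v l ≠ 0)
    have hs1 : (s : ℂ) + 1 ≠ 0 := by exact_mod_cast (by positivity : s + 1 ≠ 0)
    have h' := h s hs'
    simp only [Set.mem_ofPred_eq, IsRoot.def, P, eval_add, eval_mul, eval_C, eval_prod, hL, eval_X,
      eval_one, eval_finsetSum]
    have e : ∀ l ∈ S, c l * ∏ k ∈ S.erase l, ((s * u k + v k : ℝ) : ℂ) =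
        c l / ((s * u l + v l : ℝ) : ℂ) * ∏ k ∈ S, ((s * u k + v k : ℝ) : ℂ) := by
      intro l hl
      rw [← Finset.mul_prod_erase S _ hl]
      rw [div_mul_eq_mul_div, eq_div_iff (hne l)]
      ring
    rw [Finset.sum_congr rfl e, ← Finset.sum_mul]
    have e2 : c₀ = c₀ / ((s : ℂ) + 1) * ((s : ℂ) + 1) := by field_simp
    calc _ = (c₀ / ((s : ℂ) + 1) + ∑ l ∈ S, c l / ((s * u l + v l : ℝ) : ℂ)) * ((s : ℂ) + 1) *
          ∏ k ∈ S, ((s * u k + v k : ℝ) : ℂ) := by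
            conv_lhs => rw [e2]
            ring
      _ = 0 := by rw [h']; ring
  have h1 := congrArg (eval (-1)) hP
  simp only [P, eval_add, eval_mul, eval_C, eval_prod, eval_X, eval_one, neg_add_cancel, zero_mul,
    add_zero, eval_zero, mul_eq_zero, Finset.prod_eq_zero_iff] at h1
  rcases h1 with h1 | ⟨l, hl, h1⟩
  · exact h1
  · exfalso
    refine huv l hl ?_
    simp only [L, eval_add, eval_mul, eval_C, eval_X] at h1
    have : (v l : ℂ) = u l := by linear_combination h1
    exact_mod_cast this.symm

/-- If `q` is injective and `X`, `X'` have the same nonzero constant diagonal, the operators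
intertwining all the rescaled matrices are diagonal. -/
theorem intertwiner_diagonal {d : ℕ} {q : Fin d → ℝ} (hq : ∀ i, 0 < q i)
    (hinj : Function.Injective q) {X X' K : Mat d} {r : ℂ} (hr : r ≠ 0) (hX : ∀ i, X i i = r)
    (hX' : ∀ i, X' i i = r)
    (h : ∀ s : ℝ, 0 < s → (Matrix.of fun i j => X' i j / ((s * q i + q j : ℝ) : ℂ)) * K =
      K * Matrix.of fun i j => X i j / ((s * q i + q j : ℝ) : ℂ)) {i k : Fin d} (hik : i ≠ k) :
    K i k = 0 := by
  have hqc : ∀ i, (q i : ℂ) ≠ 0 := fun i => by exact_mod_cast (hq i).ne'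
  -- In the entry `(i, k)` of the relation, the summand `j = i` on the left and `j = k` on the right
  -- have their poles at `s = -1`; together they form `c₀`. The remaining poles are at ratios of
  -- distinct values of `q`.
  have := residue_eq_zero ((Finset.univ.erase i).disjSum (Finset.univ.erase k))
    (r * K i k / q i - K i k * r / q k)
    (Sum.elim (fun j => X' i j * K j k) (fun j => - (K i j * X j k)))
    (Sum.elim (fun _ => q i) q) (Sum.elim q (fun _ => q k))
    (by rintro (l | l) <;> exact hq _) (by rintro (l | l) <;> exact hq _)
    (by
      rintro (l | l) hl
      · simp at hl
        exact fun h => hl (hinj h).symm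
      · simp at hl
        exact fun h => hl (hinj h)) (by
      intro s hs
      have hs1 : (s : ℂ) + 1 ≠ 0 := by exact_mod_cast (by positivity : s + 1 ≠ 0)
      have hsk := congrFun (congrFun (h s hs) i) k
      rw [Matrix.mul_apply, Matrix.mul_apply,
        ← Finset.add_sum_erase _ _ (Finset.mem_univ i)] at hsk
      conv_rhs at hsk => rw [← Finset.add_sum_erase _ _ (Finset.mem_univ k)]
      simp only [Matrix.of_apply, hX, hX'] at hsk
      rw [Finset.sum_disjSum]
      simp only [Sum.elim_inl, Sum.elim_inr]
      have e1 : ∀ j, X' i j * K j k / ((s * q i + q j : ℝ) : ℂ) =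
        X' i j / ((s * q i + q j : ℝ) : ℂ) * K j k := fun j => by ring
      have e2 : ∀ j, -(K i j * X j k) / ((s * q j + q k : ℝ) : ℂ) =
        - (K i j * (X j k / ((s * q j + q k : ℝ) : ℂ))) := fun j => by ring
      simp only [e1, e2, Finset.sum_neg_distrib]
      have e3 : ∀ j, ((s * q j + q j : ℝ) : ℂ) = ((s : ℂ) + 1) * q j := fun j => by
        push_cast; ring
      rw [e3, e3] at hsk
      have e4 : (r * K i k / q i - K i k * r / q k) / ((s : ℂ) + 1) =
          r / (((s : ℂ) + 1) * q i) * K i k - K i k * (r / (((s : ℂ) + 1) * q k)) := by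
        have := hqc i; have := hqc k
        field_simp
      rw [e4]
      linear_combination hsk)
  have hne : (q k : ℂ) - q i ≠ 0 := by
    rw [sub_ne_zero]
    exact fun h => hik (hinj (by exact_mod_cast h)).symm
  have h1 := hqc i
  have h2 := hqc k
  have h3 : r * K i k * ((q k : ℂ) - q i) = 0 := by
    field_simp at this
    linear_combination this
  simpa [hr, hne] using h3

/-! ### Non-interconvertibility and irreducibility of the explicit pair -/

theorem rho3_apply_self (i : Fin 3) : rho3 i i = 1 / 3 := by
  fin_cases i <;> simp [rho3] <;> norm_num

theorem conj_rho3_apply_self (i : Fin 3) : conj rho3 i i = 1 / 3 := by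
  simp [conj, rho3_apply_self, Complex.conj_ofNat]

theorem conj_rho3_apply {i j : Fin 3} (h : i ≠ j) : conj rho3 i j = - rho3 i j := by
  fin_cases i <;> fin_cases j <;> simp_all [rho3, conj, Complex.conj_ofNat]

theorem rho3_apply_ne_zero (i j : Fin 3) : rho3 i j ≠ 0 := by
  fin_cases i <;> fin_cases j <;> simp [rho3]

/-- The obstruction is a sign around a cycle of odd length: a diagonal Kraus operator would have to
flip sign between any two of three indices. -/
theorem not_exists_channel_conj_rho3 {q : Fin 3 → ℝ} (hq : ∀ i, 0 < q i)
    (hinj : Function.Injective q) :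
    ¬ ∃ T : Mat 3 →ₗ[ℂ] Mat 3, IsChannel T ∧ T rho3 = conj rho3 ∧ T (diag q) = diag q := by
  rintro ⟨T, ⟨hcp, htr⟩, hρ, hσ⟩
  obtain ⟨K, hK⟩ := hcp.exists_kraus
  have hint : ∀ m (s : ℝ), 0 < s → _ := fun m s hs =>
    kraus_intertwine hq hK htr hσ hρ (fun i j => by simp [conj]) hs m
  have hdiag : ∀ m i k, i ≠ k → K m i k = 0 := fun m i k hik =>
    intertwiner_diagonal hq hinj (r := 1 / 3) (by norm_num) rho3_apply_self conj_rho3_apply_self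
      (hint m) hik
  have hneg : ∀ m i j, i ≠ j → K m j j = - K m i i := by
    intro m i j hij
    have h := congrFun (congrFun (hint m 1 one_pos) i) j
    rw [Matrix.mul_apply, Matrix.mul_apply, Finset.sum_eq_single j
      (fun b _ hb => by rw [hdiag m b j hb, mul_zero]) (by simp)] at h
    rw [Finset.sum_eq_single i
      (fun b _ hb => by rw [hdiag m i b hb.symm, zero_mul]) (by simp)] at h
    have hw : ((1 * q i + q j : ℝ) : ℂ) ≠ 0 := by
      have := hq i; have := hq j
      exact_mod_cast (by positivity : 1 * q i + q j ≠ 0)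
    simp only [Matrix.of_apply, conj_rho3_apply hij] at h
    have hr := rho3_apply_ne_zero i j
    exact mul_left_cancel₀ (div_ne_zero hr hw) (by linear_combination -h)
  have hzero : ∀ m, K m = 0 := by
    intro m
    have a := hneg m 0 1 (by decide)
    have b := hneg m 1 2 (by decide)
    have c := hneg m 0 2 (by decide)
    -- Going around the triangle `0, 1, 2` changes the sign three times, so `K m 0 0` equals its own
    -- negative.
    have h0 : K m 0 0 = 0 := by linear_combination (1 / 2) * (a - b + c)
    ext i j
    by_cases hij : i = j
    · subst hij
      fin_cases i
      · exact h0
      · simpa [h0] using a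
      · simpa [h0] using c
    · exact hdiag m i j hij
  have : diag q = (0 : Mat 3) := by
    rw [← hσ, hK]; simp [hzero]
  have h0 := congrFun (congrFun this 0) 0
  simp [diag, (hq 0).ne'] at h0

/-- Simple spectrum of `diag q` makes the commutant diagonal, and since `rho3` has no zero entry it
links all diagonal entries. -/
theorem isIrreducibleDichotomy_rho3 {q : Fin 3 → ℝ} (hinj : Function.Injective q) :
    IsIrreducibleDichotomy rho3 (diag q) := by
  intro A hρ hσ
  have hd : ∀ i j, i ≠ j → A i j = 0 := by
    intro i j hij
    have h := congrFun (congrFun hσ i) j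
    simp only [diag, Matrix.diagonal_mul, Matrix.mul_diagonal] at h
    have hne : (q i : ℂ) - q j ≠ 0 := by
      rw [sub_ne_zero]
      exact fun h => hij (hinj (by exact_mod_cast h))
    have : ((q i : ℂ) - q j) * A i j = 0 := by linear_combination h
    simpa [hne] using this
  have he : ∀ i j, A i i = A j j := by
    intro i j
    have h := congrFun (congrFun hρ i) j
    rw [Matrix.mul_apply, Matrix.mul_apply, Finset.sum_eq_single j
      (fun b _ hb => by rw [hd b j hb, mul_zero]) (by simp)] at h
    rw [Finset.sum_eq_single i
      (fun b _ hb => by rw [hd i b hb.symm, zero_mul]) (by simp)] at h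
    have hr := rho3_apply_ne_zero i j
    exact (mul_left_cancel₀ hr (by linear_combination h)).symm
  refine ⟨A 0 0, ?_⟩
  ext i j
  by_cases hij : i = j
  · subst hij; simp [he i 0]
  · simp [hij, hd i j hij]

/-! ### Invariance under entrywise conjugation -/

section Conj

variable {n : Type} [Fintype n] [DecidableEq n]

/-- Entrywise complex conjugation as a homomorphism of real star algebras. -/
noncomputable def conjHom (n : Type) [Fintype n] [DecidableEq n] :
    Matrix n n ℂ →⋆ₐ[ℝ] Matrix n n ℂ where
  toFun A := A.map (starRingEnd ℂ)
  map_one' := Matrix.map_one _ (map_zero _) (map_one _)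
  map_mul' A B := by ext i j; simp [Matrix.mul_apply]
  map_zero' := by ext i j; simp
  map_add' A B := by ext i j; simp
  commutes' r := by
    ext i j
    by_cases h : i = j <;> simp [h, Matrix.algebraMap_matrix_apply]
  map_star' A := by ext i j; simp [Matrix.star_apply]

@[simp] theorem conjHom_apply (A : Matrix n n ℂ) (i j : n) :
    conjHom n A i j = (starRingEnd ℂ) (A i j) := rfl

theorem conj_eq {d : ℕ} (A : Mat d) : conj A = conjHom (Fin d) A := rfl

@[simp] theorem conjHom_conjHom (A : Matrix n n ℂ) : conjHom n (conjHom n A) = A := by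
  ext i j; simp

theorem continuous_conjHom : Continuous (conjHom n) :=
  Continuous.matrix_map continuous_id Complex.continuous_conj

@[simp] theorem trace_conjHom (A : Matrix n n ℂ) :
    (conjHom n A).trace = (starRingEnd ℂ) A.trace := by
  simp [Matrix.trace]

/-- Finiteness of the spectrum removes all continuity conditions from the functional calculus, even
for the discontinuous `suppPow` and the indicator functions of `trFun`. -/
theorem continuousOn_spectrum (f : ℝ → ℝ) (A : Matrix n n ℂ) : ContinuousOn f (spectrum ℝ A) :=
  (Matrix.finite_real_spectrum (A := A)).continuousOn f

theorem isSelfAdjoint_conjHom_iff {A : Matrix n n ℂ} :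
    IsSelfAdjoint (conjHom n A) ↔ IsSelfAdjoint A := by
  refine ⟨fun h => ?_, fun h => h.map (conjHom n)⟩
  simpa using h.map (conjHom n)

/-- A continuous real star-homomorphism commutes with real functional calculus. When `A` is not
self-adjoint, both sides are the default value `0`. -/
theorem cfc_conjHom (f : ℝ → ℝ) (A : Matrix n n ℂ) :
    cfc f (conjHom n A) = conjHom n (cfc f A) := by
  by_cases h : IsSelfAdjoint A
  · exact ((conjHom n).map_cfc f A (continuousOn_spectrum f A) continuous_conjHom h
      (isSelfAdjoint_conjHom_iff.mpr h)).symm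
  · rw [cfc_apply_of_not_predicate A h,
      cfc_apply_of_not_predicate _ (mt isSelfAdjoint_conjHom_iff.mp h), map_zero]

theorem posSemidef_conjHom_iff {A : Matrix n n ℂ} :
    (conjHom n A).PosSemidef ↔ A.PosSemidef := by
  have key : ∀ {A : Matrix n n ℂ}, A.PosSemidef → (conjHom n A).PosSemidef := by
    intro A hA
    obtain ⟨B, rfl⟩ := exists_eq_conjTranspose_mul_self hA
    rw [map_mul, ← Matrix.star_eq_conjTranspose, map_star]
    exact Matrix.posSemidef_conjTranspose_mul_self _
  exact ⟨fun h => by simpa using key h, key⟩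

theorem conjHom_complex_smul (r : ℝ) (A : Matrix n n ℂ) :
    conjHom n ((r : ℂ) • A) = (r : ℂ) • conjHom n A := by
  ext i j; simp

theorem trFun_conjHom (f : ℝ → ℝ) (H S : Matrix n n ℂ) :
    trFun f (conjHom n H) (conjHom n S) = trFun f H S := by
  unfold trFun
  simp_rw [cfc_conjHom, ← map_mul, trace_conjHom, Complex.conj_re]

end Conj

variable {d : ℕ}

@[simp] theorem conj_conj (A : Mat d) : conj (conj A) = A := conjHom_conjHom A

theorem mpow_conj (s : ℝ) (A : Mat d) : mpow s (conj A) = conj (mpow s A) := cfc_conjHom _ A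

theorem mlog_conj (A : Mat d) : mlog (conj A) = conj (mlog A) := cfc_conjHom _ A

theorem conj_mul (A B : Mat d) : conj (A * B) = conj A * conj B := map_mul (conjHom (Fin d)) A B

theorem conj_sub (A B : Mat d) : conj (A - B) = conj A - conj B := map_sub (conjHom (Fin d)) A B

@[simp] theorem rtr_conj (A : Mat d) : rtr (conj A) = rtr A := by
  rw [rtr, conj_eq, trace_conjHom, Complex.conj_re, rtr]

@[simp] theorem posSemidef_conj_iff {A : Mat d} : (conj A).PosSemidef ↔ A.PosSemidef :=
  posSemidef_conjHom_iff

theorem relEntropy_conj (ρ σ : Mat d) : relEntropy (conj ρ) (conj σ) = relEntropy ρ σ := by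
  simp only [relEntropy, mlog_conj, ← conj_mul, ← conj_sub, rtr_conj]

theorem bsEntropy_conj (ρ σ : Mat d) : bsEntropy (conj ρ) (conj σ) = bsEntropy ρ σ := by
  simp only [bsEntropy, mlog_conj, mpow_conj, ← conj_mul, rtr_conj]

theorem relOp_conj (A σ : Mat d) : relOp (conj A) (conj σ) = conj (relOp A σ) := by
  simp only [relOp, mpow_conj, ← conj_mul]

theorem geomMean_conj (β : ℝ) (σ A : Mat d) :
    geomMean β (conj σ) (conj A) = conj (geomMean β σ A) := by
  simp only [geomMean, mpow_conj, relOp_conj, ← conj_mul]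

/-- The bijection of operators given by entrywise conjugation. -/
def conjEquiv (d : ℕ) : Mat d ≃ Mat d := ⟨conj, conj, conj_conj, conj_conj⟩

@[simp] theorem conjEquiv_apply (A : Mat d) : conjEquiv d A = conj A := rfl

theorem mulVec_conj (A : Mat d) (x : Fin d → ℂ) :
    (conj A).mulVec x = star (A.mulVec (star x)) := by
  ext i; simp [Matrix.mulVec, dotProduct, conj]

theorem suppLE_conj_iff {A σ : Mat d} : SuppLE (conj A) (conj σ) ↔ SuppLE A σ := by
  have key : ∀ {A σ : Mat d}, SuppLE A σ → SuppLE (conj A) (conj σ) := by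
    rintro A σ h _ ⟨x, rfl⟩
    obtain ⟨y, hy⟩ := h ⟨star x, rfl⟩
    refine ⟨star y, ?_⟩
    simp only [Matrix.mulVecLin_apply] at hy ⊢
    rw [mulVec_conj, mulVec_conj, star_star, hy]
  exact ⟨fun h => by simpa using key h, key⟩

/-- Invariance of a divergence under entrywise conjugation of both arguments. -/
def ConjInvariant (D : Divergence) : Prop :=
  ∀ (d : ℕ) (ρ σ : Mat d), D d (conj ρ) (conj σ) = D d ρ σ

/-! ### Conjugation invariance of the known divergences -/

theorem conjInvariant_petz (α : ℝ) : ConjInvariant (petz α) := fun d ρ σ => by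
  simp only [petz, relEntropy_conj, mpow_conj, ← conj_mul, rtr_conj]

theorem conjInvariant_maximal (α : ℝ) : ConjInvariant (maximal α) := fun d ρ σ => by
  simp only [maximal, bsEntropy_conj, relOp_conj, mpow_conj, ← conj_mul, rtr_conj]

theorem conjInvariant_alphaZ (α z : ℝ) : ConjInvariant (alphaZ α z) := fun d ρ σ => by
  simp only [alphaZ, relEntropy_conj, mpow_conj, ← conj_mul, rtr_conj]

theorem conjInvariant_minimal (α : ℝ) : ConjInvariant (minimal α) := fun d ρ σ => by
  simp only [minimal, relEntropy_conj, mpow_conj, ← conj_mul, rtr_conj]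

/-- Conjugating all effects permutes the measurements, and the bar can be moved from the state to
the effect inside the real trace. -/
theorem conjInvariant_measured (α : ℝ) : ConjInvariant (measured α) := fun d ρ σ => by
  simp only [measured]
  refine iSup_congr fun m => Equiv.iSup_congr (Equiv.arrowCongr (Equiv.refl _) (conjEquiv d))
    fun M => ?_
  refine iSup_congr_Prop ?_ fun _ => ?_
  · simp only [Equiv.arrowCongr_apply, Function.comp_apply, conjEquiv_apply, Equiv.refl_symm,
      Equiv.refl_apply, posSemidef_conj_iff]
    refine and_congr_right fun _ => ?_
    have : ∑ i, conj (M i) = conj (∑ i, M i) := (map_sum (conjHom (Fin d)) M Finset.univ).symm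
    rw [this]
    constructor
    · intro h
      simpa using (congrArg conj h).trans (map_one (conjHom (Fin d)))
    · rintro h
      rw [h]
      exact map_one (conjHom (Fin d))
  · simp only [Equiv.arrowCongr_apply, Function.comp_apply, conjEquiv_apply, Equiv.refl_symm,
      Equiv.refl_apply]
    have : ∀ A B : Mat d, rtr (conj A * B) = rtr (A * conj B) := fun A B => by
      rw [← rtr_conj, conj_mul, conj_conj]
    simp only [this]

theorem conjInvariant_sharp (α : ℝ) : ConjInvariant (sharp α) := fun d ρ σ => by
  simp only [sharp, bsEntropy_conj]
  have : {t : ℝ | ∃ A : Mat d, A.PosSemidef ∧ (geomMean (1 / α) (conj σ) A - conj ρ).PosSemidef ∧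
      t = rtr A} = {t : ℝ | ∃ A : Mat d, A.PosSemidef ∧ (geomMean (1 / α) σ A - ρ).PosSemidef ∧
      t = rtr A} := by
    ext t
    refine ((conjEquiv d).exists_congr fun A => ?_).symm
    simp only [conjEquiv_apply, geomMean_conj, ← conj_sub, posSemidef_conj_iff, rtr_conj]
  rw [this]

theorem conjInvariant_logEuclidean (α : ℝ) : ConjInvariant (logEuclidean α) := fun d ρ σ => by
  have hs : ∀ (r : ℝ) (A : Mat d), (r : ℂ) • conj A = conj ((r : ℂ) • A) :=
    fun r A => (conjHom_complex_smul r A).symm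
  have ha : ∀ A B : Mat d, conj A + conj B = conj (A + B) :=
    fun A B => (map_add (conjHom (Fin d)) A B).symm
  have hc : ∀ A : Mat d, cfc Real.exp (conj A) = conj (cfc Real.exp A) := cfc_conjHom _
  simp only [logEuclidean, relEntropy_conj, mpow_conj, mlog_conj, ← conj_mul, hs, ha, hc,
    rtr_conj]

theorem ConjInvariant.kringel {D : Divergence} (hD : ConjInvariant D) :
    ConjInvariant (kringel D) := fun d ρ σ => by
  simp only [QuantumDichotomy.kringel]
  refine (Equiv.iInf_congr (conjEquiv d) fun A => ?_).symm
  refine iInf_congr_Prop ?_ fun _ => ?_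
  · simp only [conjEquiv_apply, ← conj_sub, posSemidef_conj_iff, suppLE_conj_iff]
  · simp only [conjEquiv_apply, hD d A σ]

theorem ConjInvariant.barycentric {D₀ D₁ : Divergence} (h₀ : ConjInvariant D₀)
    (h₁ : ConjInvariant D₁) (α : ℝ) : ConjInvariant (barycentric α D₀ D₁) := fun d ρ σ => by
  simp only [QuantumDichotomy.barycentric]
  congr 3
  refine (Equiv.iSup_congr (conjEquiv d) fun τ => ?_).symm
  refine iSup_congr_Prop ?_ fun _ => ?_
  · simp only [conjEquiv_apply, posSemidef_conj_iff, suppLE_conj_iff]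
  · simp only [conjEquiv_apply, rtr_conj, h₀ d τ ρ, h₁ d τ σ]

/-- The induction follows the generation of Kringel and barycentric families; `α` is generalized
because a barycentric divergence uses its generators at parameter `1`. -/
theorem KnownFamily.conjInvariant {Λ : Set ℝ} {D : ℝ → Divergence} (h : KnownFamily Λ D) (α : ℝ) :
    ConjInvariant (D α) := by
  induction h generalizing α with
  | petz => exact conjInvariant_petz α
  | maximal => exact conjInvariant_maximal α
  | minimal => exact conjInvariant_minimal α
  | alphaZ Λ z h => exact conjInvariant_alphaZ α (z α)
  | measured => exact conjInvariant_measured α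
  | sharp => exact conjInvariant_sharp α
  | logEuclidean => exact conjInvariant_logEuclidean α
  | kringel Λ D h ih => exact (ih α).kringel
  | barycentric Λ₀ Λ₁ D₀ D₁ h₀ h₁ m₀ m₁ ih₀ ih₁ => exact (ih₀ 1).barycentric (ih₁ 1) α

theorem conjInvariant_maximalF (f : ℝ → ℝ) : ConjInvariant (maximalF f) := fun d ρ σ => by
  simp only [maximalF, relOp_conj]
  exact trFun_conjHom f _ _

theorem conjInvariant_standardF (f : ℝ → ℝ) : ConjInvariant (standardF f) := fun d ρ σ => by
  simp only [standardF, mpow_conj]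
  rw [← trFun_conjHom]
  congr 1
  · ext x y
    simp [conj]
  · ext x y
    simp [conj, Matrix.vecMulVec_apply]

/-! ### Trace and functional calculus inequalities -/

section Tools

variable {d : ℕ}

theorem rtr_sub (A B : Mat d) : rtr (A - B) = rtr A - rtr B := by simp [rtr]

theorem rtr_smul (r : ℝ) (A : Mat d) : rtr ((r : ℂ) • A) = r * rtr A := by simp [rtr]

theorem rtr_one : rtr (1 : Mat d) = d := by simp [rtr]

theorem rtr_mul_comm (A B : Mat d) : rtr (A * B) = rtr (B * A) := by
  rw [rtr, Matrix.trace_mul_comm, rtr]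

theorem rtr_nonneg {A : Mat d} (hA : A.PosSemidef) : 0 ≤ rtr A :=
  (Complex.nonneg_iff.mp hA.trace_nonneg).1

theorem rtr_mul_nonneg {A B : Mat d} (hA : A.PosSemidef) (hB : B.PosSemidef) :
    0 ≤ rtr (A * B) := by
  obtain ⟨C, rfl⟩ := exists_eq_conjTranspose_mul_self hB
  rw [← Matrix.mul_assoc, rtr_mul_comm, ← Matrix.mul_assoc]
  exact rtr_nonneg (hA.mul_mul_conjTranspose_same C)

theorem rtr_mul_le {A B C : Mat d} (hA : A.PosSemidef) (h : (C - B).PosSemidef) :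
    rtr (A * B) ≤ rtr (A * C) := by
  have := rtr_mul_nonneg hA h
  rw [Matrix.mul_sub, rtr_sub] at this
  linarith

theorem rtr_le {B C : Mat d} (h : (C - B).PosSemidef) : rtr B ≤ rtr C := by
  have := rtr_nonneg h
  rw [rtr_sub] at this
  linarith

theorem rtr_cfc {A : Mat d} (hA : A.IsHermitian) (f : ℝ → ℝ) :
    rtr (cfc f A) = ∑ i, f (hA.eigenvalues i) := by
  rw [hA.cfc_eq, Matrix.IsHermitian.cfc, Unitary.conjStarAlgAut_apply, rtr, Matrix.trace_mul_comm,
    ← Matrix.mul_assoc, Unitary.coe_star_mul_self, Matrix.one_mul, Matrix.trace_diagonal]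
  simp

theorem rtr_eq_sum_eigenvalues {A : Mat d} (hA : A.IsHermitian) :
    rtr A = ∑ i, hA.eigenvalues i := by
  simpa [cfc_id' ℝ A hA.isSelfAdjoint] using rtr_cfc hA (fun x => x)

section Order
open scoped MatrixOrder

theorem posSemidef_cfc_sub {A : Mat d} {f g : ℝ → ℝ} (h : ∀ x ∈ spectrum ℝ A, f x ≤ g x) :
    (cfc g A - cfc f A).PosSemidef :=
  Matrix.le_iff.mp (cfc_mono h (continuousOn_spectrum f A) (continuousOn_spectrum g A))

theorem posSemidef_cfc {A : Mat d} {f : ℝ → ℝ} (h : ∀ x ∈ spectrum ℝ A, 0 ≤ f x) :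
    (cfc f A).PosSemidef :=
  Matrix.nonneg_iff_posSemidef.mp (cfc_nonneg h)

theorem algebraMap_eq_smul (r : ℝ) : algebraMap ℝ (Mat d) r = (r : ℂ) • 1 := by
  rw [Algebra.algebraMap_eq_smul_one]
  ext i j
  simp

theorem le_of_mem_spectrum {A : Mat d} {c : ℝ} (h : (A - (c : ℂ) • 1).PosSemidef) {x : ℝ}
    (hx : x ∈ spectrum ℝ A) : c ≤ x := by
  have h1 : x - c ∈ spectrum ℝ (A - (c : ℂ) • 1) := by
    rw [← algebraMap_eq_smul, ← spectrum.sub_singleton_eq]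
    exact Set.sub_mem_sub hx (Set.mem_singleton c)
  have := spectrum_nonneg_of_nonneg h.nonneg h1
  linarith

theorem spectrum_le_of_posSemidef_sub {A : Mat d} {c : ℝ} (h : ((c : ℂ) • 1 - A).PosSemidef)
    {x : ℝ} (hx : x ∈ spectrum ℝ A) : x ≤ c := by
  have h1 : c - x ∈ spectrum ℝ ((c : ℂ) • 1 - A) := by
    rw [← algebraMap_eq_smul, ← spectrum.singleton_sub_eq]
    exact Set.sub_mem_sub (Set.mem_singleton c) hx
  have := spectrum_nonneg_of_nonneg h.nonneg h1
  linarith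

theorem spectrum_nonneg_of_posSemidef {A : Mat d} (hA : A.PosSemidef) {x : ℝ}
    (hx : x ∈ spectrum ℝ A) : 0 ≤ x :=
  spectrum_nonneg_of_nonneg hA.nonneg hx

end Order

theorem isHermitian_cfc (f : ℝ → ℝ) (A : Mat d) : (cfc f A).IsHermitian :=
  cfc_predicate f A

theorem cfc_mul_cfc (f g : ℝ → ℝ) (A : Mat d) :
    cfc f A * cfc g A = cfc (fun x => f x * g x) A :=
  (cfc_mul f g A (continuousOn_spectrum f A) (continuousOn_spectrum g A)).symm

theorem posSemidef_smul_one {c : ℝ} (hc : 0 ≤ c) : ((c : ℂ) • (1 : Mat d)).PosSemidef :=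
  Matrix.PosSemidef.one.smul (by exact_mod_cast hc)

/-- Bounds of the functional calculus by scalars. -/
theorem posSemidef_cfc_sub_smul_one {A : Mat d} (hA : A.IsHermitian) {f : ℝ → ℝ} {c : ℝ}
    (h : ∀ x ∈ spectrum ℝ A, c ≤ f x) : (cfc f A - (c : ℂ) • 1).PosSemidef := by
  rw [← algebraMap_eq_smul, ← cfc_const c A hA.isSelfAdjoint]
  exact posSemidef_cfc_sub h

theorem posSemidef_smul_one_sub_cfc {A : Mat d} (hA : A.IsHermitian) {f : ℝ → ℝ} {c : ℝ}
    (h : ∀ x ∈ spectrum ℝ A, f x ≤ c) : ((c : ℂ) • 1 - cfc f A).PosSemidef := by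
  rw [← algebraMap_eq_smul, ← cfc_const c A hA.isSelfAdjoint]
  exact posSemidef_cfc_sub h

theorem suppPow_nonneg (s : ℝ) {x : ℝ} (hx : 0 ≤ x) : 0 ≤ suppPow s x := by
  unfold suppPow; split_ifs <;> positivity

theorem suppPow_of_pos (s : ℝ) {x : ℝ} (hx : 0 < x) : suppPow s x = x ^ s := if_neg hx.ne'

theorem suppPow_eq_rpow {s : ℝ} (hs : s ≠ 0) (x : ℝ) : suppPow s x = x ^ s := by
  unfold suppPow
  split_ifs with h
  · rw [h, Real.zero_rpow hs]
  · rfl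

theorem posSemidef_mpow {A : Mat d} (hA : A.PosSemidef) (s : ℝ) : (mpow s A).PosSemidef :=
  posSemidef_cfc fun _ hx => suppPow_nonneg s (spectrum_nonneg_of_posSemidef hA hx)

theorem isHermitian_mpow (s : ℝ) (A : Mat d) : (mpow s A).IsHermitian := isHermitian_cfc _ A

theorem posSemidef_sandwich {A : Mat d} (hA : A.PosSemidef) (s : ℝ) (σ : Mat d) :
    (mpow s σ * A * mpow s σ).PosSemidef := by
  simpa only [(isHermitian_mpow s σ).eq] using hA.mul_mul_conjTranspose_same (mpow s σ)

theorem rtr_sandwich (A : Mat d) (s : ℝ) (σ : Mat d) :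
    rtr (mpow s σ * A * mpow s σ) = rtr (A * cfc (fun x => suppPow s x * suppPow s x) σ) := by
  rw [Matrix.mul_assoc, rtr_mul_comm, Matrix.mul_assoc, mpow, cfc_mul_cfc]

/-- Some eigenvalue is at least the average `c / d`, and its power alone gives the bound. -/
theorem div_rpow_le_rtr_mpow {A : Mat d} (hA : A.PosSemidef) {c s : ℝ} (hc : 0 < c)
    (hs : 0 < s) (h : c ≤ rtr A) : (c / d) ^ s ≤ rtr (mpow s A) := by
  rw [mpow, rtr_cfc hA.1]
  rw [rtr_eq_sum_eigenvalues hA.1] at h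
  have hd : 0 < (d : ℝ) := by
    rcases Nat.eq_zero_or_pos d with rfl | hd
    · simp at h; linarith
    · exact_mod_cast hd
  obtain ⟨i, -, hi⟩ : ∃ i ∈ Finset.univ, c / d ≤ hA.1.eigenvalues i := by
    by_contra! hlt
    have hne : (Finset.univ : Finset (Fin d)).Nonempty := by
      rw [Finset.univ_nonempty_iff]
      exact ⟨⟨0, by exact_mod_cast hd⟩⟩
    have := Finset.sum_lt_sum_of_nonempty hne hlt
    rw [Finset.sum_const, Finset.card_univ, Fintype.card_fin, nsmul_eq_mul,
      mul_div_cancel₀ _ hd.ne'] at this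
    linarith
  refine le_trans ?_ (Finset.single_le_sum
    (fun i _ => suppPow_nonneg s (hA.eigenvalues_nonneg i)) (Finset.mem_univ i))
  rw [suppPow_eq_rpow hs.ne']
  exact Real.rpow_le_rpow (by positivity) hi hs.le

theorem rtr_mpow_le {A : Mat d} (hA : A.PosSemidef) {s : ℝ} (hs : 0 < s) :
    rtr (mpow s A) ≤ d * rtr A ^ s := by
  rw [mpow, rtr_cfc hA.1]
  have h : ∀ i ∈ Finset.univ, suppPow s (hA.1.eigenvalues i) ≤ rtr A ^ s := by
    intro i _
    rw [suppPow_eq_rpow hs.ne', rtr_eq_sum_eigenvalues hA.1]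
    exact Real.rpow_le_rpow (hA.eigenvalues_nonneg i)
      (Finset.single_le_sum (fun i _ => hA.eigenvalues_nonneg i) (Finset.mem_univ i)) hs.le
  simpa using Finset.sum_le_card_nsmul _ _ _ h

end Tools

/-! ### Well-conditioned states -/

/-- A qutrit state `σ` with `1 / 24 ≤ σ ≤ 1`. -/
structure WellConditioned (σ : Mat 3) : Prop where
  lower : (σ - ((1 / 24 : ℝ) : ℂ) • 1).PosSemidef
  upper : (((1 : ℝ) : ℂ) • 1 - σ).PosSemidef
  trace_eq : σ.trace = 1

namespace WellConditioned

variable {σ : Mat 3} (h : WellConditioned σ)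
include h

theorem rtr_eq : rtr σ = 1 := by simp [rtr, h.trace_eq]

theorem posSemidef : σ.PosSemidef := by
  simpa using h.lower.add (posSemidef_smul_one (d := 3) (c := 1 / 24) (by norm_num))

theorem le_spectrum {x : ℝ} (hx : x ∈ spectrum ℝ σ) : 1 / 24 ≤ x := le_of_mem_spectrum h.lower hx

theorem pos_spectrum {x : ℝ} (hx : x ∈ spectrum ℝ σ) : 0 < x := by
  have := h.le_spectrum hx
  linarith

theorem spectrum_le {x : ℝ} (hx : x ∈ spectrum ℝ σ) : x ≤ 1 :=
  spectrum_le_of_posSemidef_sub h.upper hx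

theorem one_le_suppPow {s : ℝ} (hs : s ≤ 0) {x : ℝ} (hx : x ∈ spectrum ℝ σ) :
    1 ≤ suppPow s x := by
  rw [suppPow_of_pos s (h.pos_spectrum hx)]
  exact Real.one_le_rpow_of_pos_of_le_one_of_nonpos (h.pos_spectrum hx) (h.spectrum_le hx) hs

theorem rtr_le_mul_mpow {A : Mat 3} (hA : A.PosSemidef) {s : ℝ} (hs : s ≤ 0) :
    rtr A ≤ rtr (A * mpow s σ) := by
  have := rtr_mul_le hA (posSemidef_cfc_sub_smul_one (c := 1) (f := suppPow s) h.posSemidef.1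
    fun x hx => h.one_le_suppPow hs hx)
  simpa [mpow] using this

theorem rtr_le_sandwich {A : Mat 3} (hA : A.PosSemidef) {s : ℝ} (hs : s ≤ 0) :
    rtr A ≤ rtr (mpow s σ * A * mpow s σ) := by
  have := rtr_mul_le hA (posSemidef_cfc_sub_smul_one (c := 1) h.posSemidef.1
    (f := fun x => suppPow s x * suppPow s x) fun x hx => by
      have := h.one_le_suppPow hs hx
      nlinarith)
  rw [rtr_sandwich]
  simpa using this

/-- By cyclicity the left side is `tr (A σ⁻¹)`, and `σ⁻¹ ≤ 24`. -/
theorem rtr_relOp_le {A : Mat 3} (hA : A.PosSemidef) : rtr (relOp A σ) ≤ 24 * rtr A := by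
  have := rtr_mul_le hA (posSemidef_smul_one_sub_cfc (c := 24) h.posSemidef.1
    (f := fun x => suppPow (-(1 / 2)) x * suppPow (-(1 / 2)) x) fun x hx => by
      have hx0 := h.pos_spectrum hx
      have hx1 := h.le_spectrum hx
      simp only [suppPow_of_pos _ hx0, ← Real.rpow_add hx0]
      norm_num
      rw [Real.rpow_neg_one, inv_le_comm₀ hx0 (by norm_num)]
      linarith)
  rw [relOp, rtr_sandwich]
  refine this.trans (le_of_eq ?_)
  rw [Matrix.mul_smul, rtr_smul, Matrix.mul_one]

theorem rtr_le_relOp {A : Mat 3} (hA : A.PosSemidef) : rtr A ≤ rtr (relOp A σ) :=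
  h.rtr_le_sandwich hA (by norm_num)

theorem rtr_sandwich_half_le {A : Mat 3} (hA : A.PosSemidef) :
    rtr (mpow (1 / 2) σ * A * mpow (1 / 2) σ) ≤ rtr A := by
  have := rtr_mul_le hA (posSemidef_smul_one_sub_cfc (c := 1) h.posSemidef.1
    (f := fun x => suppPow (1 / 2) x * suppPow (1 / 2) x) fun x hx => by
      have hx0 := h.pos_spectrum hx
      have hx1 := h.spectrum_le hx
      simp only [suppPow_of_pos _ hx0, ← Real.rpow_add hx0]
      norm_num
      exact hx1)
  rw [rtr_sandwich]
  simpa using this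

theorem suppLE (A : Mat 3) : SuppLE A σ := by
  have hu : IsUnit σ := by
    by_contra hn
    have h0 : (0 : ℝ) ∈ spectrum ℝ σ := by
      rw [spectrum.zero_mem_iff]; exact hn
    exact (h.pos_spectrum h0).ne' rfl
  have : LinearMap.range σ.mulVecLin = ⊤ :=
    LinearMap.range_eq_top.mpr (Matrix.mulVec_surjective_iff_isUnit.mpr hu)
  rw [SuppLE, this]
  exact le_top

theorem isState : IsState σ := ⟨h.posSemidef, h.trace_eq⟩

end WellConditioned

/-! ### Lower bounds on unnormalized first arguments -/

theorem le_renyi_of_le {α c Q : ℝ} (hα : 1 < α) (hc : 0 < c) (h : c ≤ Q) :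
    1 / (α - 1) * Real.log c ≤ 1 / (α - 1) * Real.log Q := by
  have : 0 ≤ 1 / (α - 1) := by
    have : 0 < α - 1 := by linarith
    positivity
  exact mul_le_mul_of_nonneg_left (Real.log_le_log hc h) this

/-- `D` is bounded below on operators of trace at least one, relative to `σ`. -/
def BoundedBelow (D : Divergence) (σ : Mat 3) : Prop :=
  ∃ c : ℝ, ∀ A : Mat 3, A.PosSemidef → 1 ≤ rtr A → (c : EReal) ≤ D 3 A σ

section LowerBounds

variable {σ : Mat 3} (h : WellConditioned σ) {α : ℝ} (hα : 1 < α)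
include h hα

theorem boundedBelow_petz : BoundedBelow (petz α) σ := by
  refine ⟨1 / (α - 1) * Real.log ((1 / (3 : ℕ)) ^ α), fun A hA h1 => ?_⟩
  simp only [petz, if_neg hα.ne', EReal.coe_le_coe_iff]
  exact le_renyi_of_le hα (by positivity)
    ((div_rpow_le_rtr_mpow hA one_pos (by linarith : 0 < α) h1).trans
      (h.rtr_le_mul_mpow (posSemidef_mpow hA α) (by linarith)))

theorem boundedBelow_maximal : BoundedBelow (maximal α) σ := by
  refine ⟨1 / (α - 1) * Real.log (1 / 24 * (1 / (3 : ℕ)) ^ α), fun A hA h1 => ?_⟩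
  simp only [maximal, if_neg hα.ne', EReal.coe_le_coe_iff]
  have hR : (relOp A σ).PosSemidef := posSemidef_sandwich hA _ σ
  have h2 := div_rpow_le_rtr_mpow hR one_pos (by linarith : 0 < α)
    (h1.trans (h.rtr_le_relOp hA))
  have h4 := rtr_mul_nonneg (posSemidef_mpow hR α) h.lower
  rw [Matrix.mul_sub, rtr_sub, Matrix.mul_smul, Matrix.mul_one, rtr_smul,
    rtr_mul_comm] at h4
  exact le_renyi_of_le hα (by positivity) (by linarith)

theorem boundedBelow_alphaZ {z : ℝ} (hz : 0 < z) : BoundedBelow (alphaZ α z) σ := by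
  refine ⟨1 / (α - 1) * Real.log (((1 / (3 : ℕ)) ^ (α / z) / (3 : ℕ)) ^ z), fun A hA h1 => ?_⟩
  simp only [alphaZ, if_neg hα.ne', EReal.coe_le_coe_iff]
  have h2 := div_rpow_le_rtr_mpow hA one_pos (by positivity : 0 < α / z) h1
  have h3 := h.rtr_le_sandwich (posSemidef_mpow hA (α / z))
    (div_nonpos_of_nonpos_of_nonneg (by linarith) (by linarith) : (1 - α) / (2 * z) ≤ 0)
  exact le_renyi_of_le hα (by positivity)
    (div_rpow_le_rtr_mpow (posSemidef_sandwich (posSemidef_mpow hA _) _ σ) (by positivity) hz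
      (h2.trans h3))

theorem boundedBelow_minimal : BoundedBelow (minimal α) σ := by
  refine ⟨1 / (α - 1) * Real.log ((1 / (3 : ℕ)) ^ α), fun A hA h1 => ?_⟩
  simp only [minimal, if_neg hα.ne', EReal.coe_le_coe_iff]
  have h3 := h.rtr_le_sandwich hA
    (div_nonpos_of_nonpos_of_nonneg (by linarith) (by linarith) : (1 - α) / (2 * α) ≤ 0)
  exact le_renyi_of_le hα (by positivity)
    (div_rpow_le_rtr_mpow (posSemidef_sandwich hA _ σ) one_pos (by linarith) (h1.trans h3))

theorem boundedBelow_measured : BoundedBelow (measured α) σ := by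
  refine ⟨0, fun A hA h1 => ?_⟩
  refine le_trans ?_ (le_iSup₂_of_le 1 (fun _ => 1)
    (le_iSup_of_le ⟨fun _ => Matrix.PosSemidef.one, by simp⟩ le_rfl))
  rw [EReal.coe_le_coe_iff, classicalRenyi, if_neg hα.ne']
  simp only [Matrix.one_mul, h.rtr_eq, Finset.univ_unique, Finset.sum_const,
    Finset.card_singleton, one_smul]
  rw [suppPow_of_pos _ one_pos, Real.one_rpow, mul_one, suppPow_of_pos _ (by linarith)]
  have : 0 < α - 1 := by linarith
  have := Real.log_nonneg (Real.one_le_rpow h1 (by linarith : 0 ≤ α))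
  positivity

theorem boundedBelow_sharp : BoundedBelow (sharp α) σ := by
  have hα0 : 0 < α := by linarith
  have hα1 : 0 < α - 1 := by linarith
  set b : ℝ := (1 / 3) ^ α / 24 with hb
  have hb0 : 0 < b := by positivity
  refine ⟨min 0 (1 / (α - 1) * Real.log b), fun A hA h1 => ?_⟩
  simp only [sharp, if_neg hα.ne', EReal.coe_le_coe_iff]
  set S : Set ℝ := _
  change _ ≤ 1 / (α - 1) * Real.log (sInf S)
  -- On an empty set `sInf` is `0`, and `Real.log 0 = 0`; this default value is why the bound is a
  -- minimum with `0`.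
  rcases S.eq_empty_or_nonempty with hS | hS
  · rw [hS]; simp
  refine (min_le_right _ _).trans (le_renyi_of_le hα hb0 (le_csInf hS ?_))
  rintro t ⟨B, hB, hBA, rfl⟩
  have hR : (relOp B σ).PosSemidef := posSemidef_sandwich hB _ σ
  have e1 : 1 ≤ 3 * (24 * rtr B) ^ (1 / α) :=
    calc 1 ≤ rtr A := h1
      _ ≤ rtr (geomMean (1 / α) σ B) := rtr_le hBA
      _ ≤ rtr (mpow (1 / α) (relOp B σ)) := h.rtr_sandwich_half_le (posSemidef_mpow hR _)
      _ ≤ 3 * rtr (relOp B σ) ^ (1 / α) := by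
        simpa using rtr_mpow_le hR (by positivity : 0 < 1 / α)
      _ ≤ 3 * (24 * rtr B) ^ (1 / α) := by
        have := Real.rpow_le_rpow (rtr_nonneg hR) (h.rtr_relOp_le hB)
          (by positivity : 0 ≤ 1 / α)
        linarith
  have hB0 : 0 ≤ 24 * rtr B := by have := rtr_nonneg hB; positivity
  have e2 : (1 / 3 : ℝ) ^ α ≤ 24 * rtr B := by
    have := Real.rpow_le_rpow (by norm_num) (by linarith : (1 / 3 : ℝ) ≤ (24 * rtr B) ^ (1 / α))
      hα0.le
    rwa [← Real.rpow_mul hB0, one_div_mul_cancel hα0.ne', Real.rpow_one] at this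
  rw [hb]; linarith

end LowerBounds

theorem BoundedBelow.kringel {D : Divergence} {σ : Mat 3} (h : BoundedBelow D σ) :
    BoundedBelow (kringel D) σ := by
  obtain ⟨c, hc⟩ := h
  refine ⟨c, fun A hA h1 => le_iInf₂ fun B hB => hc B ?_ (h1.trans (rtr_le hB.1))⟩
  simpa using hB.1.add hA

/-- Needed so that the infimum over `A ≥ ρ` in a Kringel divergence is not `⊥`. Every such `A` has
trace at least one, so the bound passes even to iterated Kringel constructions. -/
theorem KnownFamily.boundedBelow {Λ : Set ℝ} {D : ℝ → Divergence} (hD : KnownFamily Λ D)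
    {σ : Mat 3} (h : WellConditioned σ) {α : ℝ} (hα : 1 < α) (hΛ : α ∈ Λ) :
    BoundedBelow (D α) σ := by
  induction hD with
  | petz => exact boundedBelow_petz h hα
  | maximal => exact boundedBelow_maximal h hα
  | minimal => exact boundedBelow_minimal h hα
  | alphaZ Λ z hz =>
    refine boundedBelow_alphaZ h hα ?_
    rcases hz α hΛ with h | h | h | h <;> linarith [h.1, h.2]
  | measured => exact boundedBelow_measured h hα
  | sharp => exact boundedBelow_sharp h hα
  | logEuclidean => exact absurd hΛ.2 (by linarith)
  | kringel Λ D h ih => exact (ih hΛ.1).kringel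
  | barycentric Λ₀ Λ₁ D₀ D₁ h₀ h₁ m₀ m₁ => exact absurd hΛ.2 (by linarith)

/-! ### Finiteness of the measured divergences -/

/-- A classical Rényi divergence is at most the max-divergence. -/
theorem classicalRenyi_le_log {m : ℕ} {α C : ℝ} (hC : 0 < C) {p q : Fin m → ℝ}
    (hp : ∀ i, 0 ≤ p i) (hpq : ∀ i, p i ≤ C * q i) (hsum : ∑ i, p i = 1) :
    classicalRenyi α p q ≤ Real.log C := by
  have hq : ∀ i, 0 < p i → 0 < q i := fun i hi =>
    pos_of_mul_pos_right (hi.trans_le (hpq i)) hC.le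
  unfold classicalRenyi
  split_ifs with h1
  · calc ∑ i, p i * Real.log (p i / q i) ≤ ∑ i, p i * Real.log C := by
          refine Finset.sum_le_sum fun i _ => ?_
          rcases (hp i).eq_or_lt with h | h
          · simp [← h]
          · refine mul_le_mul_of_nonneg_left (Real.log_le_log (div_pos h (hq i h)) ?_) (hp i)
            rw [div_le_iff₀ (hq i h)]
            exact hpq i
      _ = Real.log C := by rw [← Finset.sum_mul, hsum, one_mul]
  -- As an average of `(p / q) ^ (α - 1)` under `p`, the sum is compared with `C ^ (α - 1)`. For `α
  -- < 1` this comparison and the prefactor both reverse sign.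
  · have key : ∀ i, 0 < p i → suppPow α (p i) * suppPow (1 - α) (q i) =
        p i * (p i / q i) ^ (α - 1) := by
      intro i hi
      have hqi := hq i hi
      rw [suppPow_of_pos _ hi, suppPow_of_pos _ hqi, Real.div_rpow hi.le hqi.le,
        Real.rpow_sub_one hi.ne', ← neg_sub α 1, Real.rpow_neg hqi.le]
      field_simp
    have key0 : ∀ i, p i = 0 → suppPow α (p i) * suppPow (1 - α) (q i) = 0 := by
      intro i hi
      simp [hi, suppPow]
    have hsumC : ∑ i, p i * C ^ (α - 1) = C ^ (α - 1) := by rw [← Finset.sum_mul, hsum, one_mul]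
    have hlogC : Real.log C = 1 / (α - 1) * Real.log (C ^ (α - 1)) := by
      rw [Real.log_rpow hC]
      have : α - 1 ≠ 0 := sub_ne_zero.mpr h1
      field_simp
    have hdiv : ∀ i, 0 < p i → p i / q i ≤ C := fun i hi => by
      rw [div_le_iff₀ (hq i hi)]; exact hpq i
    rw [hlogC]
    have hnn : ∀ i, 0 ≤ suppPow α (p i) * suppPow (1 - α) (q i) := by
      intro i
      rcases (hp i).eq_or_lt with h | h
      · exact (key0 i h.symm).ge
      · rw [key i h]
        have := hq i h
        positivity
    rcases lt_or_gt_of_ne h1 with hlt | hgt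
    · have : 1 / (α - 1) ≤ 0 := one_div_nonpos.mpr (by linarith)
      refine mul_le_mul_of_nonpos_left (Real.log_le_log (by positivity) ?_) this
      rw [← hsumC]
      refine Finset.sum_le_sum fun i _ => ?_
      rcases (hp i).eq_or_lt with h | h
      · rw [key0 i h.symm, ← h, zero_mul]
      · rw [key i h]
        exact mul_le_mul_of_nonneg_left (Real.rpow_le_rpow_of_nonpos (div_pos h (hq i h))
          (hdiv i h) (by linarith)) (hp i)
    · have h0 : 0 ≤ 1 / (α - 1) := one_div_nonneg.mpr (by linarith)
      refine mul_le_mul_of_nonneg_left ?_ h0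
      have hpos : 0 < ∑ i, suppPow α (p i) * suppPow (1 - α) (q i) := by
        obtain ⟨i, hi⟩ : ∃ i, 0 < p i := by
          by_contra! hcon
          have := Finset.sum_nonpos fun i (_ : i ∈ Finset.univ) => hcon i
          linarith
        refine Finset.sum_pos' (fun i _ => hnn i) ⟨i, Finset.mem_univ i, ?_⟩
        have := hq i hi
        rw [key i hi]
        positivity
      refine Real.log_le_log hpos ?_
      rw [← hsumC]
      refine Finset.sum_le_sum fun i _ => ?_
      rcases (hp i).eq_or_lt with h | h
      · rw [key0 i h.symm, ← h, zero_mul]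
      · rw [key i h]
        have := hq i h
        exact mul_le_mul_of_nonneg_left (Real.rpow_le_rpow (by positivity)
          (hdiv i h) (by linarith)) (hp i)

theorem WellConditioned.le_smul {ρ σ : Mat 3} (hρ : WellConditioned ρ) (hσ : WellConditioned σ) :
    (((24 : ℝ) : ℂ) • σ - ρ).PosSemidef := by
  have h := (hσ.lower.smul (a := ((24 : ℝ) : ℂ)) (by norm_num [Complex.zero_le_real])).add hρ.upper
  convert h using 1
  rw [smul_sub, smul_smul]
  norm_num

theorem measured_ne_top {ρ σ : Mat 3} (hρ : WellConditioned ρ) (hσ : WellConditioned σ)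
    (α : ℝ) : measured α 3 ρ σ ≠ ⊤ := by
  refine ne_top_of_le_ne_top (EReal.coe_ne_top (Real.log 24))
    (iSup₂_le fun m M => iSup_le fun hM => ?_)
  rw [EReal.coe_le_coe_iff]
  refine classicalRenyi_le_log (by norm_num)
    (fun i => rtr_mul_nonneg (hM.1 i) hρ.posSemidef) (fun i => ?_) ?_
  · have := rtr_mul_le (hM.1 i) (hρ.le_smul hσ)
    rwa [Matrix.mul_smul, rtr_smul] at this
  · have : ∑ i, rtr (M i * ρ) = rtr ((∑ i, M i) * ρ) := by
      simp [rtr, Finset.sum_mul, Matrix.trace_sum]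
    rw [this, hM.2, Matrix.one_mul, hρ.rtr_eq]

theorem measured_ne_bot {d : ℕ} (ρ σ : Mat d) (α : ℝ) : measured α d ρ σ ≠ ⊥ := by
  refine ne_bot_of_le_ne_bot (EReal.coe_ne_bot _) (le_iSup₂_of_le 1 (fun _ => 1)
    (le_iSup_of_le ⟨fun _ => Matrix.PosSemidef.one, by simp⟩ le_rfl))

/-! ### Relative entropies and barycentric divergences -/

/-- Two-sided control of a relative entropy: a linear lower bound in the trace of the first
argument, and nonpositivity on scalars below the second argument. -/
structure EntropyBounds (D : Divergence) (σ : Mat 3) : Prop where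
  lower : ∀ τ : Mat 3, τ.PosSemidef → ((rtr τ - 3 : ℝ) : EReal) ≤ D 3 τ σ
  upper : D 3 (((1 / 24 : ℝ) : ℂ) • 1) σ ≤ 0

theorem cfc_smul_one {d : ℕ} (f : ℝ → ℝ) (c : ℝ) :
    cfc f ((c : ℂ) • (1 : Mat d)) = (f c : ℂ) • 1 := by
  rw [← algebraMap_eq_smul, ← algebraMap_eq_smul, cfc_algebraMap]

theorem sub_one_le_mul_log {x : ℝ} (hx : 0 ≤ x) : x - 1 ≤ x * Real.log x := by
  rcases hx.eq_or_lt with rfl | h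
  · simp
  · have := Real.one_sub_inv_le_log_of_pos h
    calc x - 1 = x * (1 - x⁻¹) := by field_simp
      _ ≤ _ := mul_le_mul_of_nonneg_left this hx

section Bounds

variable {σ : Mat 3} (h : WellConditioned σ)
include h

theorem entropyBounds_of_eq_relEntropy {D : Divergence}
    (hD : ∀ ρ σ : Mat 3, D 3 ρ σ = (relEntropy ρ σ : EReal)) : EntropyBounds D σ := by
  constructor
  · intro τ hτ
    rw [hD, EReal.coe_le_coe_iff, relEntropy, Matrix.mul_sub, rtr_sub]
    have h1 : rtr (τ * mlog σ) ≤ 0 := by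
      have : (((0 : ℝ) : ℂ) • 1 - mlog σ).PosSemidef :=
        posSemidef_smul_one_sub_cfc h.posSemidef.1 fun x hx =>
          Real.log_nonpos (h.pos_spectrum hx).le (h.spectrum_le hx)
      simpa [rtr] using rtr_mul_le hτ this
    have h2 : rtr τ - 3 ≤ rtr (τ * mlog τ) := by
      have e : τ * mlog τ = cfc (fun x => x * Real.log x) τ := by
        conv_lhs => enter [1]; rw [← cfc_id' ℝ τ hτ.1.isSelfAdjoint]
        rw [mlog, cfc_mul_cfc]
      rw [e, rtr_cfc hτ.1, rtr_eq_sum_eigenvalues hτ.1]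
      have := Finset.sum_le_sum fun i (_ : i ∈ Finset.univ) =>
        sub_one_le_mul_log (hτ.eigenvalues_nonneg i)
      simpa using this
    linarith
  · rw [hD, ← EReal.coe_zero, EReal.coe_le_coe_iff, relEntropy, mlog, cfc_smul_one,
      Matrix.smul_mul, rtr_smul, Matrix.one_mul]
    have : (mlog σ - ((Real.log (1 / 24) : ℝ) : ℂ) • 1).PosSemidef :=
      posSemidef_cfc_sub_smul_one h.posSemidef.1 fun x hx =>
        Real.log_le_log (by norm_num) (h.le_spectrum hx)
    have := rtr_le this
    rw [rtr_sub]
    linarith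

/-- The Belavkin–Staszewski lower bound `tr τ - tr σ`. -/
theorem le_bsEntropy {τ : Mat 3} (hτ : τ.PosSemidef) : rtr τ - rtr σ ≤ bsEntropy τ σ := by
  set A := mpow (1 / 2) τ with hA
  set B := mpow (-(1 / 2)) σ with hB
  set C := mpow (1 / 2) σ with hC
  have hAH : Aᴴ = A := isHermitian_mpow _ _
  have hBH : Bᴴ = B := isHermitian_mpow _ _
  have hCH : Cᴴ = C := isHermitian_mpow _ _
  have hself : ∀ {Y : Mat 3}, Y.IsHermitian → cfc (fun x : ℝ => x) Y = Y :=
    fun hY => cfc_id' ℝ _ hY.isSelfAdjoint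
  have hAA : A * A = τ := by
    conv_rhs => rw [← hself hτ.1]
    rw [hA, mpow, cfc_mul_cfc]
    refine cfc_congr fun x hx => ?_
    have hx0 := spectrum_nonneg_of_posSemidef hτ hx
    simp only [suppPow_eq_rpow (by norm_num : (1 / 2 : ℝ) ≠ 0), ← Real.sqrt_eq_rpow,
      Real.mul_self_sqrt hx0]
  have hCC : C * C = σ := by
    conv_rhs => rw [← hself h.posSemidef.1]
    rw [hC, mpow, cfc_mul_cfc]
    refine cfc_congr fun x hx => ?_
    have hx0 := spectrum_nonneg_of_posSemidef h.posSemidef hx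
    simp only [suppPow_eq_rpow (by norm_num : (1 / 2 : ℝ) ≠ 0), ← Real.sqrt_eq_rpow,
      Real.mul_self_sqrt hx0]
  have hBB : B * B = mpow (-1) σ := by
    rw [hB, mpow, mpow, cfc_mul_cfc]
    refine cfc_congr fun x hx => ?_
    have hx0 := h.pos_spectrum hx
    simp only [suppPow_of_pos _ hx0, ← Real.rpow_add hx0]
    norm_num
  have hBC : B * C = 1 := by
    rw [hB, hC, mpow, mpow, cfc_mul_cfc, ← cfc_const_one ℝ σ h.posSemidef.1.isSelfAdjoint]
    refine cfc_congr fun x hx => ?_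
    have hx0 := h.pos_spectrum hx
    simp only [suppPow_of_pos _ hx0, ← Real.rpow_add hx0]
    norm_num
  set G := A * B with hG
  have hGC : G * C = A := by rw [hG, Matrix.mul_assoc, hBC, Matrix.mul_one]
  have hGCH : C * Gᴴ = A := by rw [← hCH, ← Matrix.conjTranspose_mul, hGC, hAH]
  have hX : A * mpow (-1) σ * A = G * Gᴴ := by
    rw [← hBB, hG, Matrix.conjTranspose_mul, hAH, hBH]
    simp only [Matrix.mul_assoc]
  rw [bsEntropy, ← hA, hX]
  set X := G * Gᴴ with hXdef
  have hXpos : X.PosSemidef := Matrix.posSemidef_self_mul_conjTranspose G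
  set P := mpow 0 X with hP
  set W := mpow (-1) X with hW
  have hPH : Pᴴ = P := isHermitian_mpow _ _
  have hWH : Wᴴ = W := isHermitian_mpow _ _
  have hPX : P * X = X := by
    conv_lhs => enter [2]; rw [← hself hXpos.1]
    conv_rhs => rw [← hself hXpos.1]
    rw [hP, mpow, cfc_mul_cfc]
    refine cfc_congr fun x _ => ?_
    by_cases hx : x = 0 <;> simp [suppPow, hx]
  have hWXW : W * X * W = W := by
    conv_lhs => enter [1, 2]; rw [← hself hXpos.1]
    rw [hW, mpow, cfc_mul_cfc, cfc_mul_cfc]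
    refine cfc_congr fun x _ => ?_
    by_cases hx : x = 0 <;> simp [suppPow, hx, Real.rpow_neg_one]
  have hPG : P * G = G := by
    have h0 : (P * G - G) * (P * G - G)ᴴ = 0 := by
      have : (P * G - G) * (P * G - G)ᴴ = P * X * P - P * X - (X * P - X) := by
        rw [Matrix.conjTranspose_sub, Matrix.conjTranspose_mul, hPH, hXdef]
        noncomm_ring
      rw [this, hPX]
      noncomm_ring
    exact sub_eq_zero.mp (Matrix.self_mul_conjTranspose_eq_zero.mp h0)
  have hτP : rtr (τ * P) = rtr τ := by
    rw [rtr_mul_comm, ← hAA, ← Matrix.mul_assoc]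
    conv_lhs => enter [1, 1]; rw [← hGC, ← Matrix.mul_assoc, hPG, hGC]
  -- Since `W` inverts `X = G Gᴴ` on its support, `Q` is an orthogonal projection, hence at most
  -- `1`.
  set Q := Gᴴ * W * G with hQ
  have hQH : Qᴴ = Q := by
    simpa only [hWH] using (Matrix.isHermitian_conjTranspose_mul_mul G hWH).eq
  have hQQ : Q * Q = Q := by
    calc Q * Q = Gᴴ * (W * X * W) * G := by rw [hQ, hXdef]; noncomm_ring
      _ = Q := by rw [hWXW]
  have hQle : (1 - Q).PosSemidef := by
    have := Matrix.posSemidef_conjTranspose_mul_self (1 - Q)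
    rwa [Matrix.conjTranspose_sub, Matrix.conjTranspose_one, hQH, Matrix.sub_mul, Matrix.mul_sub,
      Matrix.mul_sub, hQQ, Matrix.one_mul, Matrix.one_mul, Matrix.mul_one, sub_self,
      sub_zero] at this
  have hτW : rtr (τ * W) = rtr (σ * Q) := by
    have : τ * W = G * (σ * Gᴴ * W) := by
      rw [← hAA, ← hCC]
      conv_lhs => enter [1, 1]; rw [← hGC]
      conv_lhs => enter [1, 2]; rw [← hGCH]
      simp only [Matrix.mul_assoc]
    rw [this, rtr_mul_comm, hQ]
    simp only [Matrix.mul_assoc]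
  -- The scalar inequality `log x ≥ 1 - 1 / x` on the support of `X`. Tested against `τ`, its right
  -- side is `tr τ - tr (σ Q) ≥ tr τ - tr σ`.
  have hlog : (mlog X - (P - W)).PosSemidef := by
    rw [hP, hW, mpow, mpow, ← cfc_sub (suppPow 0) (suppPow (-1)) X (continuousOn_spectrum _ X)
      (continuousOn_spectrum _ X)]
    refine posSemidef_cfc_sub fun x hx => ?_
    rcases (spectrum_nonneg_of_posSemidef hXpos hx).eq_or_lt with rfl | hx0
    · simp [suppPow]
    · rw [suppPow_of_pos _ hx0, suppPow_of_pos _ hx0, Real.rpow_zero, Real.rpow_neg_one]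
      exact Real.one_sub_inv_le_log_of_pos hx0
  have e1 := rtr_mul_le hτ hlog
  have e2 := rtr_mul_le h.posSemidef hQle
  rw [Matrix.mul_sub, rtr_sub, hτP, hτW] at e1
  rw [Matrix.mul_one] at e2
  linarith

theorem entropyBounds_of_eq_bsEntropy {D : Divergence}
    (hD : ∀ ρ σ : Mat 3, D 3 ρ σ = (bsEntropy ρ σ : EReal)) : EntropyBounds D σ := by
  constructor
  · intro τ hτ
    rw [hD, EReal.coe_le_coe_iff]
    have := le_bsEntropy h hτ
    rw [h.rtr_eq] at this
    linarith
  · rw [hD, ← EReal.coe_zero, EReal.coe_le_coe_iff, bsEntropy, Matrix.smul_mul, rtr_smul,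
      Matrix.one_mul]
    refine mul_nonpos_of_nonneg_of_nonpos (by norm_num) ?_
    set s : ℝ := suppPow (1 / 2) (1 / 24) with hs
    have hss : s * s = 1 / 24 := by
      rw [hs, suppPow_of_pos _ (by norm_num), ← Real.rpow_add (by norm_num)]
      norm_num
    have hX : mpow (1 / 2) (((1 / 24 : ℝ) : ℂ) • (1 : Mat 3)) * mpow (-1) σ *
        mpow (1 / 2) (((1 / 24 : ℝ) : ℂ) • (1 : Mat 3)) = ((1 / 24 : ℝ) : ℂ) • mpow (-1) σ := by
      rw [mpow, cfc_smul_one, ← hs, Matrix.smul_mul, Matrix.one_mul, Matrix.mul_smul,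
        Matrix.mul_one, smul_smul, ← Complex.ofReal_mul, hss]
    rw [hX]
    have hp : (((1 / 24 : ℝ) : ℂ) • mpow (-1) σ).PosSemidef :=
      (posSemidef_mpow h.posSemidef _).smul (Complex.zero_le_real.mpr (by norm_num))
    have hinv : (((24 : ℝ) : ℂ) • 1 - mpow (-1) σ).PosSemidef :=
      posSemidef_smul_one_sub_cfc h.posSemidef.1 fun x hx => by
        rw [suppPow_of_pos _ (h.pos_spectrum hx), Real.rpow_neg_one,
          inv_le_comm₀ (h.pos_spectrum hx) (by norm_num)]
        linarith [h.le_spectrum hx]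
    have hle : (((1 : ℝ) : ℂ) • 1 - ((1 / 24 : ℝ) : ℂ) • mpow (-1) σ).PosSemidef := by
      have := hinv.smul (a := ((1 / 24 : ℝ) : ℂ)) (Complex.zero_le_real.mpr (by norm_num))
      rw [smul_sub, smul_smul, ← Complex.ofReal_mul] at this
      norm_num at this ⊢
      exact this
    have : (((0 : ℝ) : ℂ) • 1 - mlog (((1 / 24 : ℝ) : ℂ) • mpow (-1) σ)).PosSemidef :=
      posSemidef_smul_one_sub_cfc hp.1 fun x hx =>
        Real.log_nonpos (spectrum_nonneg_of_posSemidef hp hx) (spectrum_le_of_posSemidef_sub hle hx)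
    simpa [rtr] using rtr_le this

theorem entropyBounds_measured : EntropyBounds (measured 1) σ := by
  constructor
  · intro τ hτ
    refine le_trans ?_ (le_iSup₂_of_le 1 (fun _ => 1)
      (le_iSup_of_le ⟨fun _ => Matrix.PosSemidef.one, by simp⟩ le_rfl))
    rw [EReal.coe_le_coe_iff, classicalRenyi, if_pos rfl]
    simp only [Matrix.one_mul, h.rtr_eq, Finset.univ_unique, Finset.sum_const,
      Finset.card_singleton, one_smul, div_one]
    have := sub_one_le_mul_log (rtr_nonneg hτ)
    linarith
  · refine iSup₂_le fun m M => iSup_le fun hM => ?_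
    rw [← EReal.coe_zero, EReal.coe_le_coe_iff, classicalRenyi, if_pos rfl]
    refine Finset.sum_nonpos fun i _ => ?_
    have h0 := rtr_nonneg (hM.1 i)
    have h1 := rtr_mul_le (hM.1 i) h.lower
    rw [Matrix.mul_smul, Matrix.mul_one, rtr_smul] at h1 ⊢
    have h2 : 0 ≤ 1 / 24 * rtr (M i) := by positivity
    refine mul_nonpos_of_nonneg_of_nonpos h2
      (Real.log_nonpos (div_nonneg h2 (h2.trans h1)) (div_le_one_of_le₀ h1 (h2.trans h1)))

theorem KnownFamily.entropyBounds {Λ : Set ℝ} {D : ℝ → Divergence} (hD : KnownFamily Λ D)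
    (hΛ : (1 : ℝ) ∈ Λ) : EntropyBounds (D 1) σ := by
  cases hD with
  | petz => exact entropyBounds_of_eq_relEntropy h fun ρ σ => by simp [QuantumDichotomy.petz]
  | maximal => exact entropyBounds_of_eq_bsEntropy h fun ρ σ => by simp [QuantumDichotomy.maximal]
  | minimal => exact entropyBounds_of_eq_relEntropy h fun ρ σ => by simp [QuantumDichotomy.minimal]
  | alphaZ Λ z hz => exact entropyBounds_of_eq_relEntropy h fun ρ σ => by simp [QuantumDichotomy.alphaZ]
  | measured => exact entropyBounds_measured h
  | sharp => exact entropyBounds_of_eq_bsEntropy h fun ρ σ => by simp [QuantumDichotomy.sharp]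
  | logEuclidean => exact entropyBounds_of_eq_relEntropy h fun ρ σ => by simp [QuantumDichotomy.logEuclidean]
  | kringel Λ D h => exact (lt_irrefl (1 : ℝ) hΛ.2).elim
  | barycentric Λ₀ Λ₁ D₀ D₁ h₀ h₁ m₀ m₁ => exact (lt_irrefl (1 : ℝ) hΛ.2).elim

end Bounds

/-- The supremum lies between `1 / 8` and `3`, so its logarithm is finite. -/
theorem barycentric_ne_top_bot {D₀ D₁ : Divergence} {ρ σ : Mat 3} (hρ : WellConditioned ρ)
    (h₀ : EntropyBounds D₀ ρ) (h₁ : EntropyBounds D₁ σ) {α : ℝ} (hα0 : 0 ≤ α) (hα1 : α < 1) :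
    barycentric α D₀ D₁ 3 ρ σ ≠ ⊤ ∧ barycentric α D₀ D₁ 3 ρ σ ≠ ⊥ := by
  have a0 : (0 : EReal) ≤ (α : EReal) := EReal.coe_nonneg.mpr hα0
  have a1 : (0 : EReal) ≤ ((1 - α : ℝ) : EReal) := EReal.coe_nonneg.mpr (by linarith)
  set S : EReal := ⨆ (τ : Mat 3) (_ : τ.PosSemidef ∧ SuppLE τ ρ),
      ((rtr τ : EReal) - (α : EReal) * D₀ 3 τ ρ - ((1 - α : ℝ) : EReal) * D₁ 3 τ σ) with hS
  have hlow : ((1 / 8 : ℝ) : EReal) ≤ S := by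
    refine le_iSup₂_of_le (((1 / 24 : ℝ) : ℂ) • 1)
      ⟨posSemidef_smul_one (by norm_num), hρ.suppLE _⟩ ?_
    have e : rtr (((1 / 24 : ℝ) : ℂ) • (1 : Mat 3)) = 1 / 8 := by
      rw [rtr_smul, rtr_one]; norm_num
    rw [e]
    have b0 : (α : EReal) * D₀ 3 (((1 / 24 : ℝ) : ℂ) • 1) ρ ≤ 0 :=
      (mul_le_mul_of_nonneg_left h₀.upper a0).trans (mul_zero _).le
    have b1 : ((1 - α : ℝ) : EReal) * D₁ 3 (((1 / 24 : ℝ) : ℂ) • 1) σ ≤ 0 :=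
      (mul_le_mul_of_nonneg_left h₁.upper a1).trans (mul_zero _).le
    calc ((1 / 8 : ℝ) : EReal) = ((1 / 8 : ℝ) : EReal) - 0 - 0 := by simp
      _ ≤ _ := EReal.sub_le_sub (EReal.sub_le_sub le_rfl b0) b1
  -- The entropy lower bounds have slope exactly one in `tr τ`, and the weights `α`, `1 - α` add up
  -- to one, so `tr τ` cancels and only the constant `3` remains.
  have hupp : S ≤ ((3 : ℝ) : EReal) := by
    refine iSup₂_le fun τ hτ => ?_
    have b0 := mul_le_mul_of_nonneg_left (h₀.lower τ hτ.1) a0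
    have b1 := mul_le_mul_of_nonneg_left (h₁.lower τ hτ.1) a1
    refine (EReal.sub_le_sub (EReal.sub_le_sub le_rfl b0) b1).trans (le_of_eq ?_)
    rw [← EReal.coe_mul, ← EReal.coe_mul, ← EReal.coe_sub, ← EReal.coe_sub]
    congr 1
    ring
  have hpos : 0 < S := lt_of_lt_of_le (by norm_num) hlow
  have htop : S ≠ ⊤ := ne_top_of_le_ne_top (EReal.coe_ne_top _) hupp
  have hlog : ENNReal.log S.toENNReal = ((ENNReal.log S.toENNReal).toReal : EReal) := by
    refine (EReal.coe_toReal ?_ ?_).symm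
    · rw [Ne, ENNReal.log_eq_top_iff, EReal.toENNReal_eq_top_iff]
      exact htop
    · rw [Ne, ENNReal.log_eq_bot_iff, EReal.toENNReal_eq_zero_iff]
      exact hpos.not_ge
  have : barycentric α D₀ D₁ 3 ρ σ =
      ((1 / (α - 1) * (ENNReal.log S.toENNReal).toReal : ℝ) : EReal) := by
    rw [EReal.coe_mul, ← hlog]
    rfl
  rw [this]
  exact ⟨EReal.coe_ne_top _, EReal.coe_ne_bot _⟩

/-- Closed formulas and the sharp divergence are real-valued by definition. A Kringel divergence is
bounded above by the choice `A = ρ`. -/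
theorem KnownFamily.ne_top_bot {Λ : Set ℝ} {D : ℝ → Divergence} (hD : KnownFamily Λ D)
    {ρ σ : Mat 3} (hρ : WellConditioned ρ) (hσ : WellConditioned σ) {α : ℝ} (hα : α ∈ Λ) :
    D α 3 ρ σ ≠ ⊤ ∧ D α 3 ρ σ ≠ ⊥ := by
  induction hD with
  | petz => exact ⟨EReal.coe_ne_top _, EReal.coe_ne_bot _⟩
  | maximal => exact ⟨EReal.coe_ne_top _, EReal.coe_ne_bot _⟩
  | minimal => exact ⟨EReal.coe_ne_top _, EReal.coe_ne_bot _⟩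
  | alphaZ Λ z h => exact ⟨EReal.coe_ne_top _, EReal.coe_ne_bot _⟩
  | measured => exact ⟨measured_ne_top hρ hσ α, measured_ne_bot ρ σ α⟩
  | sharp => exact ⟨EReal.coe_ne_top _, EReal.coe_ne_bot _⟩
  | logEuclidean => exact ⟨EReal.coe_ne_top _, EReal.coe_ne_bot _⟩
  | kringel Λ D h ih =>
    constructor
    · refine ne_top_of_le_ne_top (ih hα.1).1 (iInf₂_le ρ ⟨?_, hσ.suppLE ρ⟩)
      rw [sub_self]
      exact Matrix.PosSemidef.zero
    · obtain ⟨c, hc⟩ := (h.boundedBelow hσ hα.2 hα.1).kringel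
      exact ne_bot_of_le_ne_bot (EReal.coe_ne_bot c) (hc ρ hρ.posSemidef hρ.rtr_eq.ge)
  | barycentric Λ₀ Λ₁ D₀ D₁ h₀ h₁ m₀ m₁ =>
    exact barycentric_ne_top_bot hρ (h₀.entropyBounds hρ m₀) (h₁.entropyBounds hσ m₁) hα.1 hα.2

/-! ### The explicit dichotomy -/

/-- The off-diagonal part of `6 • rho3`. -/
def offDiag3 : Mat 3 :=
  !![0, Complex.I, Complex.I; -Complex.I, 0, Complex.I; -Complex.I, -Complex.I, 0]

theorem offDiag3_sq_mul : offDiag3 * offDiag3 * offDiag3 = (3 : ℂ) • offDiag3 := by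
  have hI := Complex.I_mul_I
  ext i j
  fin_cases i <;> fin_cases j <;>
    simp [offDiag3, Matrix.mul_apply, Fin.sum_univ_three] <;> ring

theorem conjTranspose_offDiag3 : offDiag3ᴴ = offDiag3 := by
  ext i j
  fin_cases i <;> fin_cases j <;> simp [offDiag3]

/-- The spectrum of `offDiag3` is contained in `[-√3, √3]`, and `√3 < 7 / 4`. -/
theorem posSemidef_smul_one_add_offDiag3 {a : ℝ} (ha : 7 / 4 ≤ a) :
    ((a : ℂ) • 1 + offDiag3).PosSemidef := by
  set H := offDiag3 with hH
  have hHH : Hᴴ = H := conjTranspose_offDiag3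
  have hcube : H * H * H = (3 : ℂ) • H := offDiag3_sq_mul
  have p1 : ((H + ((7 / 4 : ℝ) : ℂ) • 1) * (H + ((7 / 4 : ℝ) : ℂ) • 1)).PosSemidef := by
    have := Matrix.posSemidef_conjTranspose_mul_self (H + ((7 / 4 : ℝ) : ℂ) • 1)
    simpa only [Matrix.conjTranspose_add, Matrix.conjTranspose_smul, Matrix.conjTranspose_one,
      hHH, RCLike.star_def, Complex.conj_ofReal] using this
  have p2 : (((3 : ℂ) • 1 - H * H) * ((3 : ℂ) • 1 - H * H)).PosSemidef := by
    have := Matrix.posSemidef_conjTranspose_mul_self ((3 : ℂ) • 1 - H * H)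
    simpa only [Matrix.conjTranspose_sub, Matrix.conjTranspose_smul, Matrix.conjTranspose_one,
      Matrix.conjTranspose_mul, hHH, RCLike.star_def, Complex.conj_ofNat] using this
  have p3 : ((((7 / 2) * a - 97 / 16 : ℝ) : ℂ) • (1 : Mat 3)).PosSemidef :=
    posSemidef_smul_one (by linarith)
  have hr : ∀ r : ℝ, 0 ≤ r → (0 : ℂ) ≤ (r : ℂ) := fun r h => Complex.zero_le_real.mpr h
  -- From `H³ = 3H` one gets `(3 - H²)² = 9 - 3H²`, so these weights cancel `H²` and leave `H + 97 /
  -- 56`. The third summand supplies `a - 97 / 56`, and `97 / 56 < 7 / 4`.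
  have := ((p1.smul (hr (2 / 7) (by norm_num))).add
    (p2.smul (hr (2 / 21) (by norm_num)))).add (p3.smul (hr (2 / 7) (by norm_num)))
  convert this using 1
  have e : ((3 : ℂ) • 1 - H * H) * ((3 : ℂ) • 1 - H * H) = (9 : ℂ) • 1 - (3 : ℂ) • (H * H) := by
    have h4 : H * H * (H * H) = (3 : ℂ) • (H * H) := by
      rw [← Matrix.mul_assoc, hcube, Matrix.smul_mul]
    simp only [Matrix.sub_mul, Matrix.mul_sub, h4, Matrix.smul_mul, Matrix.mul_smul,
      Matrix.one_mul, Matrix.mul_one]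
    module
  rw [e]
  simp only [Matrix.add_mul, Matrix.mul_add, Matrix.smul_mul, Matrix.mul_smul, Matrix.one_mul,
    Matrix.mul_one]
  push_cast
  module

theorem rho3_eq : rho3 = ((1 / 6 : ℝ) : ℂ) • (((2 : ℝ) : ℂ) • 1 + offDiag3) := by
  ext i j
  fin_cases i <;> fin_cases j <;> simp [rho3, offDiag3]

theorem conj_offDiag3 : conj offDiag3 = - offDiag3 := by
  ext i j
  fin_cases i <;> fin_cases j <;> simp [offDiag3, conj]

theorem conj_smul_one_add_offDiag3 (a : ℝ) :
    conj ((a : ℂ) • 1 + offDiag3) = (a : ℂ) • 1 - offDiag3 := by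
  rw [conj_eq, map_add, conjHom_complex_smul, map_one, ← conj_eq, conj_offDiag3, sub_eq_add_neg]

theorem wellConditioned_rho3 : WellConditioned rho3 where
  lower := by
    have := (posSemidef_smul_one_add_offDiag3 (le_refl (7 / 4))).smul
      (Complex.zero_le_real.mpr (by norm_num : (0 : ℝ) ≤ 1 / 6))
    convert this using 1
    rw [rho3_eq]
    push_cast
    module
  upper := by
    have := (posSemidef_conj_iff.mpr (posSemidef_smul_one_add_offDiag3
      (by norm_num : (7 / 4 : ℝ) ≤ 4))).smul
      (Complex.zero_le_real.mpr (by norm_num : (0 : ℝ) ≤ 1 / 6))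
    rw [conj_smul_one_add_offDiag3] at this
    convert this using 1
    rw [rho3_eq]
    push_cast
    module
  trace_eq := by
    simp [Matrix.trace, rho3_apply_self]

theorem isState_diag {d : ℕ} {q : Fin d → ℝ} (hq : ∀ i, 0 ≤ q i) (hsum : ∑ i, q i = 1) :
    IsState (diag q) := by
  refine ⟨Matrix.PosSemidef.diagonal fun i => Complex.zero_le_real.mpr (hq i), ?_⟩
  rw [diag, Matrix.trace_diagonal, ← Complex.ofReal_sum, hsum, Complex.ofReal_one]

theorem suppLE_diag {d : ℕ} {q : Fin d → ℝ} (hq : ∀ i, 0 < q i) (A : Mat d) :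
    SuppLE A (diag q) := by
  intro y _
  refine ⟨fun i => y i / q i, ?_⟩
  ext i
  have : (q i : ℂ) ≠ 0 := by exact_mod_cast (hq i).ne'
  rw [Matrix.mulVecLin_apply, diag, Matrix.mulVec_diagonal]
  field_simp

theorem isState_conj {d : ℕ} {ρ : Mat d} (h : IsState ρ) : IsState (conj ρ) :=
  ⟨posSemidef_conj_iff.mpr h.1, by rw [conj_eq, trace_conjHom, h.2, map_one]⟩

@[simp] theorem conj_diag {d : ℕ} (q : Fin d → ℝ) : conj (diag q) = diag q := by
  ext i j
  by_cases h : i = j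
  · subst h; simp [conj, diag]
  · simp [conj, diag, h]

theorem isDichotomy_rho3 {q : Fin 3 → ℝ} (hq : ∀ i, 0 < q i) (hsum : ∑ i, q i = 1) :
    IsDichotomy rho3 (diag q) :=
  ⟨wellConditioned_rho3.isState, isState_diag (fun i => (hq i).le) hsum, suppLE_diag hq _⟩

theorem isDichotomy_conj_rho3 {q : Fin 3 → ℝ} (hq : ∀ i, 0 < q i) (hsum : ∑ i, q i = 1) :
    IsDichotomy (conj rho3) (diag q) :=
  ⟨isState_conj wellConditioned_rho3.isState, isState_diag (fun i => (hq i).le) hsum,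
    suppLE_diag hq _⟩

theorem not_interconvertible_conj_rho3 {q : Fin 3 → ℝ} (hq : ∀ i, 0 < q i)
    (hinj : Function.Injective q) :
    ¬ Interconvertible rho3 (diag q) (conj rho3) (diag q) :=
  fun h => not_exists_channel_conj_rho3 hq hinj h.1

/-- The spectrum of a reference full-rank state. -/
noncomputable def refSpectrum : Fin 3 → ℝ := ![1 / 6, 1 / 3, 1 / 2]

theorem refSpectrum_ge (i : Fin 3) : 1 / 24 ≤ refSpectrum i := by
  fin_cases i <;> norm_num [refSpectrum]

theorem refSpectrum_le (i : Fin 3) : refSpectrum i ≤ 1 := by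
  fin_cases i <;> norm_num [refSpectrum]

theorem refSpectrum_pos (i : Fin 3) : 0 < refSpectrum i := by
  have := refSpectrum_ge i; linarith

theorem sum_refSpectrum : ∑ i, refSpectrum i = 1 := by
  simp [refSpectrum, Fin.sum_univ_three]
  norm_num

theorem refSpectrum_injective : Function.Injective refSpectrum := by
  intro i j h
  fin_cases i <;> fin_cases j <;> first | rfl | norm_num [refSpectrum] at h

theorem wellConditioned_diag_refSpectrum : WellConditioned (diag refSpectrum) where
  lower := by
    have : diag refSpectrum - ((1 / 24 : ℝ) : ℂ) • 1 =
        Matrix.diagonal fun i => ((refSpectrum i - 1 / 24 : ℝ) : ℂ) := by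
      rw [diag, Matrix.smul_one_eq_diagonal, Matrix.diagonal_sub]
      simp
    rw [this]
    exact Matrix.PosSemidef.diagonal fun i =>
      Complex.zero_le_real.mpr (by have := refSpectrum_ge i; linarith)
  upper := by
    have : ((1 : ℝ) : ℂ) • 1 - diag refSpectrum =
        Matrix.diagonal fun i => ((1 - refSpectrum i : ℝ) : ℂ) := by
      rw [diag, Matrix.smul_one_eq_diagonal, Matrix.diagonal_sub]
      simp
    rw [this]
    exact Matrix.PosSemidef.diagonal fun i =>
      Complex.zero_le_real.mpr (by have := refSpectrum_le i; linarith)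
  trace_eq := (isState_diag (fun i => (refSpectrum_pos i).le) sum_refSpectrum).2

theorem isDichotomy_ref : IsDichotomy rho3 (diag refSpectrum) :=
  isDichotomy_rho3 refSpectrum_pos sum_refSpectrum

theorem isDichotomy_conj_ref : IsDichotomy (conj rho3) (diag refSpectrum) :=
  isDichotomy_conj_rho3 refSpectrum_pos sum_refSpectrum

theorem not_interconvertible_ref :
    ¬ Interconvertible rho3 (diag refSpectrum) (conj rho3) (diag refSpectrum) :=
  not_interconvertible_conj_rho3 refSpectrum_pos refSpectrum_injective

/-! ### Criteria for insufficiency -/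

theorem not_isSufficientCollection {S : Set Divergence}
    (hS : ∀ D ∈ S, D 3 (conj rho3) (diag refSpectrum) = D 3 rho3 (diag refSpectrum)) :
    ¬ IsSufficientCollection S := fun h =>
  not_interconvertible_ref (h _ _ _ _ _ _ isDichotomy_ref isDichotomy_conj_ref
    fun D hD => (hS D hD).symm)

/-- Equality of the divergences transfers finiteness from the reference pair to its conjugate, so
one finiteness hypothesis is enough. -/
theorem not_isSufficient {Λ : Set ℝ} {D : ℝ → Divergence}
    (hΛ : ∃ a b : ℝ, a < b ∧ Set.Ioo a b ⊆ Λ)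
    (hD : ∀ α ∈ Λ, D α 3 (conj rho3) (diag refSpectrum) = D α 3 rho3 (diag refSpectrum))
    (hfin : ∀ α ∈ Λ, D α 3 rho3 (diag refSpectrum) ≠ ⊤ ∧ D α 3 rho3 (diag refSpectrum) ≠ ⊥) :
    ¬ IsSufficient Λ D := by
  obtain ⟨a, b, hab, hsub⟩ := hΛ
  intro h
  refine not_interconvertible_ref ((h _ _ _ _ _ _ isDichotomy_ref isDichotomy_conj_ref a b hab hsub
    fun α hα => ?_).mpr fun α hα => (hD α (hsub hα)).symm)
  rw [hD α (hsub hα)]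
  exact ⟨hfin α (hsub hα), hfin α (hsub hα)⟩

theorem ConjInvariant.eq_ref {D : Divergence} (h : ConjInvariant D) :
    D 3 (conj rho3) (diag refSpectrum) = D 3 rho3 (diag refSpectrum) := by
  simpa using h 3 rho3 (diag refSpectrum)

/-! ### Finiteness of abstract Rényi families -/

/-- The trace as a channel to the trivial system. -/
def traceChannel (d : ℕ) : Mat d →ₗ[ℂ] Mat 1 where
  toFun A := A.trace • 1
  map_add' A B := by rw [Matrix.trace_add, add_smul]
  map_smul' c A := by rw [Matrix.trace_smul, smul_assoc, RingHom.id_apply]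

/-- The channel preparing `τ i` on the classical input `i`. -/
def prepare {m d : ℕ} (τ : Fin m → Mat d) : Mat m →ₗ[ℂ] Mat d where
  toFun A := ∑ i, A i i • τ i
  map_add' A B := by simp [add_smul, Finset.sum_add_distrib]
  map_smul' c A := by simp [mul_smul, Finset.smul_sum]

theorem isCompletelyPositive_traceChannel (d : ℕ) : IsCompletelyPositive (traceChannel d) := by
  intro k M hM
  -- The partial trace is a sum of principal submatrices.
  have : ampliate k (traceChannel d) M = ∑ a : Fin d,
      M.submatrix (fun x : Fin k × Fin 1 => (x.1, a)) (fun x : Fin k × Fin 1 => (x.1, a)) := by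
    ext x y
    simp [ampliate, traceChannel, Matrix.trace, Matrix.sum_apply, Matrix.one_apply,
      Subsingleton.elim x.2 y.2]
  rw [this]
  exact Matrix.posSemidef_sum _ fun a _ => hM.submatrix _

theorem isChannel_traceChannel (d : ℕ) : IsChannel (traceChannel d) :=
  ⟨isCompletelyPositive_traceChannel d, fun A => by simp [traceChannel]⟩

theorem isChannel_prepare {m d : ℕ} {τ : Fin m → Mat d} (hτ : ∀ i, IsState (τ i)) :
    IsChannel (prepare τ) := by
  constructor
  · intro k M hM
    -- Only the blocks diagonal in the classical index survive, each tensored with the prepared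
    -- state.
    have : ampliate k (prepare τ) M = ∑ i : Fin m,
        (M.submatrix (fun x : Fin k => (x, i)) (fun x : Fin k => (x, i))) ⊗ₖ τ i := by
      ext x y
      simp [ampliate, prepare, Matrix.sum_apply, Matrix.kroneckerMap_apply]
    rw [this]
    exact Matrix.posSemidef_sum _ fun i _ => (hM.submatrix _).kronecker (hτ i).1
  · intro A
    simp [prepare, Matrix.trace_sum, (hτ _).2]
    rfl

/-- Data processing under the trace bounds the divergence below by its value on the trivial system,
which is a classical and therefore real number. -/
theorem IsRenyiFamily.ne_bot {Λ : Set ℝ} {D : ℝ → Divergence} (hD : IsRenyiFamily Λ D) {α : ℝ}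
    (hα : α ∈ Λ) {d : ℕ} {ρ σ : Mat d} (h : IsDichotomy ρ σ) : D α d ρ σ ≠ ⊥ := by
  have h1 := hD.dataProcessing α hα d 1 ρ σ _ h (isChannel_traceChannel d)
  have e : (1 : Mat 1) = Matrix.diagonal fun i => (((fun _ => 1 : Fin 1 → ℝ) i : ℝ) : ℂ) := by
    simp
  have h2 : IsState (1 : Mat 1) := ⟨Matrix.PosSemidef.one, by simp⟩
  have h3 := hD.classical α hα 1 (fun _ => 1) (fun _ => 1) (by
    rw [← e]; exact ⟨h2, h2, le_rfl⟩)
  rw [← e] at h3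
  have e1 : ∀ {A : Mat d}, IsState A → traceChannel d A = 1 := fun hA => by
    simp [traceChannel, hA.2]
  rw [e1 h.1, e1 h.2.1, h3] at h1
  exact ne_bot_of_le_ne_bot (EReal.coe_ne_bot _) h1

/-- Divergences in a Rényi family are finite when `σ` dominates a multiple of `ρ`. -/
theorem IsRenyiFamily.ne_top {Λ : Set ℝ} {D : ℝ → Divergence} (hD : IsRenyiFamily Λ D) {α : ℝ}
    (hα : α ∈ Λ) {d : ℕ} {ρ σ : Mat d} (hρ : IsState ρ) (hσ : IsState σ) {c : ℝ} (hc0 : 0 < c)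
    (hc1 : c < 1) (h : (σ - (c : ℂ) • ρ).PosSemidef) : D α d ρ σ ≠ ⊤ := by
  have hc : ((1 - c : ℝ) : ℂ) ≠ 0 := by
    exact_mod_cast (by linarith : (1 - c : ℝ) ≠ 0)
  -- Since `σ = c ρ + (1 - c) ω`, the pair is prepared from the classical dichotomy `(1, 0)`, `(c, 1
  -- - c)`, whose finite divergence bounds that of `(ρ, σ)`.
  set ω : Mat d := (((1 - c)⁻¹ : ℝ) : ℂ) • (σ - (c : ℂ) • ρ) with hω
  have hωs : IsState ω := by
    refine ⟨h.smul (Complex.zero_le_real.mpr (inv_nonneg.mpr (by linarith))), ?_⟩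
    rw [hω, Matrix.trace_smul, Matrix.trace_sub, Matrix.trace_smul, hρ.2, hσ.2]
    push_cast at hc ⊢
    simp only [smul_eq_mul, mul_one]
    exact inv_mul_cancel₀ hc
  have hch : IsChannel (prepare ![ρ, ω]) := isChannel_prepare fun i => by
    fin_cases i
    · exact hρ
    · exact hωs
  have hdich : IsDichotomy (diag ![1, 0]) (diag ![c, 1 - c]) := by
    refine ⟨isState_diag (fun i => ?_) (by simp), isState_diag (fun i => ?_) (by simp),
      suppLE_diag (fun i => ?_) _⟩
    · fin_cases i <;> simp
    · fin_cases i <;> simp <;> linarith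
    · fin_cases i <;> simp <;> linarith
  have h1 := hD.dataProcessing α hα _ _ _ _ _ hdich hch
  have e1 : prepare ![ρ, ω] (diag ![1, 0]) = ρ := by
    simp [prepare, diag, Fin.sum_univ_two]
  have e2 : prepare ![ρ, ω] (diag ![c, 1 - c]) = σ := by
    have : ((1 - c : ℝ) : ℂ) • ω = σ - (c : ℂ) • ρ := by
      rw [hω, smul_smul, Complex.ofReal_inv, mul_inv_cancel₀ hc, one_smul]
    simp only [prepare, diag, Fin.sum_univ_two, LinearMap.coe_mk, AddHom.coe_mk,
      Matrix.diagonal_apply_eq, Matrix.cons_val_zero, Matrix.cons_val_one, this]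
    simp
  have h2 := hD.classical α hα 2 ![1, 0] ![c, 1 - c] hdich
  rw [e1, e2] at h1
  exact ne_top_of_le_ne_top (h2 ▸ EReal.coe_ne_top _) h1

theorem IsRenyiFamily.ne_top_bot_ref {Λ : Set ℝ} {D : ℝ → Divergence} (hD : IsRenyiFamily Λ D)
    {α : ℝ} (hα : α ∈ Λ) :
    D α 3 rho3 (diag refSpectrum) ≠ ⊤ ∧ D α 3 rho3 (diag refSpectrum) ≠ ⊥ := by
  refine ⟨hD.ne_top hα isDichotomy_ref.1 isDichotomy_ref.2.1 (c := 1 / 24) (by norm_num)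
    (by norm_num) ?_, hD.ne_bot hα isDichotomy_ref⟩
  have := (wellConditioned_rho3.le_smul wellConditioned_diag_refSpectrum).smul
    (Complex.zero_le_real.mpr (by norm_num : (0 : ℝ) ≤ 1 / 24))
  convert this using 1
  rw [smul_sub, smul_smul]
  norm_num

/-- The anti-unitary is plain complex conjugation, `U = 1`, which fixes the real matrix `diag
refSpectrum`. -/
theorem IsAntiUnitarilyInvariant.eq_ref {Λ : Set ℝ} {D : ℝ → Divergence}
    (hD : IsAntiUnitarilyInvariant Λ D) {α : ℝ} (hα : α ∈ Λ) :
    D α 3 (conj rho3) (diag refSpectrum) = D α 3 rho3 (diag refSpectrum) := by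
  simpa using hD α hα 3 rho3 (diag refSpectrum) 1 isDichotomy_ref (one_mem _)

end QuantumDichotomy

theorem lemma3p7 :
    -- the explicit irreducible dichotomy, not interconvertible with its complex conjugate;
    -- `σ = diag q` is any full-rank state with simple spectrum
    (∀ q : Fin 3 → ℝ, (∀ i, 0 < q i) → ∑ i, q i = 1 → Function.Injective q →
      QuantumDichotomy.IsDichotomy QuantumDichotomy.rho3 (QuantumDichotomy.diag q) ∧
      QuantumDichotomy.IsDichotomy (QuantumDichotomy.conj QuantumDichotomy.rho3)
        (QuantumDichotomy.diag q) ∧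
      QuantumDichotomy.IsIrreducibleDichotomy QuantumDichotomy.rho3 (QuantumDichotomy.diag q) ∧
      ¬ QuantumDichotomy.Interconvertible QuantumDichotomy.rho3 (QuantumDichotomy.diag q)
        (QuantumDichotomy.conj QuantumDichotomy.rho3) (QuantumDichotomy.diag q)) ∧
    -- anti-unitarily invariant families of quantum Rényi divergences are not sufficient
    (∀ (Λ : Set ℝ) (D : ℝ → QuantumDichotomy.Divergence), Λ ⊆ Set.Ici 0 →
      QuantumDichotomy.IsRenyiFamily Λ D → QuantumDichotomy.IsAntiUnitarilyInvariant Λ D →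
        ((∃ a b : ℝ, a < b ∧ Set.Ioo a b ⊆ Λ) → ¬ QuantumDichotomy.IsSufficient Λ D) ∧
        ¬ QuantumDichotomy.IsSufficientCollection (D '' Λ)) ∧
    -- none of the known families is sufficient
    (∀ (Λ : Set ℝ) (D : ℝ → QuantumDichotomy.Divergence), QuantumDichotomy.KnownFamily Λ D →
      (∃ a b : ℝ, a < b ∧ Set.Ioo a b ⊆ Λ) → ¬ QuantumDichotomy.IsSufficient Λ D) ∧
    ¬ QuantumDichotomy.IsSufficientCollection QuantumDichotomy.standardFDivergences ∧
    ¬ QuantumDichotomy.IsSufficientCollection QuantumDichotomy.maximalFDivergences ∧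
    -- nor is the collection of all of them
    ¬ QuantumDichotomy.IsSufficientCollection
      (QuantumDichotomy.knownRenyiDivergences ∪ QuantumDichotomy.standardFDivergences ∪
        QuantumDichotomy.maximalFDivergences) := by
  open QuantumDichotomy in
  refine ⟨fun q hq hsum hinj => ⟨isDichotomy_rho3 hq hsum, isDichotomy_conj_rho3 hq hsum,
      isIrreducibleDichotomy_rho3 hinj, not_interconvertible_conj_rho3 hq hinj⟩,
    fun Λ D _ hD hinv => ⟨fun hΛ => not_isSufficient hΛ (fun α hα => hinv.eq_ref hα)
      fun α hα => hD.ne_top_bot_ref hα, not_isSufficientCollection ?_⟩,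
    fun Λ D hD hΛ => not_isSufficient hΛ (fun α _ => (hD.conjInvariant α).eq_ref)
      fun α hα => hD.ne_top_bot wellConditioned_rho3 wellConditioned_diag_refSpectrum hα,
    not_isSufficientCollection ?_, not_isSufficientCollection ?_, not_isSufficientCollection ?_⟩
  · rintro _ ⟨α, hα, rfl⟩
    exact hinv.eq_ref hα
  · rintro _ ⟨f, -, rfl⟩
    exact (conjInvariant_standardF f).eq_ref
  · rintro _ ⟨f, -, rfl⟩
    exact (conjInvariant_maximalF f).eq_ref
  · rintro _ ((⟨Λ, F, hF, α, -, rfl⟩ | ⟨f, -, rfl⟩) | ⟨f, -, rfl⟩)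
    · exact (hF.conjInvariant α).eq_ref
    · exact (conjInvariant_standardF f).eq_ref
    · exact (conjInvariant_maximalF f).eq_ref
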